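/- **Setting.** Let $\mathcal X$ be a measurable space and let $\mathcal F$ be a nonempty class of measurable classifiers $f:\mathcal X\to\{0,1\}$ of VC dimension $d<\infty$. There are $k\ge 1$ players with probability distributions $D_1,\dots,D_k$ on $\mathcal X\times\{0,1\}$. Write $\mathrm{err}_D(f)=\Pr_{(x,y)\sim D}[f(x)\ne y]$, let $\mathrm{err}_S(f)$ be the fraction of a finite sample $S$ that $f$ mislabels, and let $\mathrm{OPT}=\inf_{f\in\mathcal F}\max_{i\in[k]}\mathrm{err}_{D_i}(f)$. Let $\mathcal O_{\mathcal F}$ be an empirical risk minimizer: it maps each finite sample $S$ to some $\mathcal O_{\mathcal F}(S)\in\mathcal F$ with $\mathrm{err}_S(\mathcal O_{\mathcal F}(S))=\min_{f\in\mathcal F}\mathrm{err}_S(f)$, and $(S,x)\mapsto\mathcal O_{\mathcal F}(S)(x)$ is measurable on samples of each fixed size. **Algorithm NR2-AVG** (with constants $c_S,c_T$). Put $\alpha'=\alpha/15$, $\epsilon'=\epsilon/29$, $t=2\lceil \ln(4k/\delta)/(\epsilon'\alpha'^2)\rceil$, $\delta'=\delta/(4t)$, and $w_i^{(0)}=1$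 for $i\in[k]$. In each round $r=1,\dots,t$: - draw a sample $S^{(r)}$ of size $\big\lceil \frac{c_S}{\alpha'\epsilon'}\big(d\ln\frac1{\epsilon'}+\ln\frac1{\delta'}\big)\big\rceil$ from the mixture $\sum_i w_i^{(r-1)}D_i\big/\sum_i w_i^{(r-1)}$; - let $f^{(r)}=\mathcal O_{\mathcal F}(S^{(r)})$; - for each $i\in[k]$, draw a sample $T_i$ of size $\big\lceil\frac{c_T}{\alpha'\epsilon'}\ln\frac1{\epsilon'}\big\rceil$ from $D_i$, and set $w_i^{(r)}=w_i^{(r-1)}(1+s_i^{(r)})$ with $$s_i^{(r)}=\frac{\mathrm{err}_{T_i}(f^{(r)})\,\epsilon'\alpha'}{(1+3\alpha')\,\mathrm{err}_{S^{(r)}}(f^{(r)})+3\epsilon'}.$$ Output the randomized classifier $f_{\text{NR2-AVG}}$ that, given $x$, picks $r\in[t]$ uniformly at random and returns $f^{(r)}(x)$. Its expected error $\overline{\mathrm{err}}_{D}(f_{\text{NR2-AVG}})$ is the probability of a wrong label over both $(x,y)\sim D$ and the choice of $r$. **Theorem.** There is a universal constant $c_0>0$ such that for all constants $c_S,c_T\ge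 c_0$ there is a constant $K$, depending only on $c_S$ and $c_T$, for which the following holds. For all $\epsilon,\delta\in(0,1)$ and $30\epsilon/29<\alpha<1$, and all $\mathcal X,\mathcal F,d,k,D_1,\dots,D_k,\mathcal O_{\mathcal F}$ as above, with probability at least $1-\delta$ over the samples drawn, $$\overline{\mathrm{err}}_{D_i}(f_{\text{NR2-AVG}})\le(1+\alpha)\,\mathrm{OPT}+\epsilon\qquad\text{for all } i\in[k].$$ Moreover, if $k\ge 2\delta$ (that is, unless $k=1$ and $\delta>1/2$), the total number $m$ of samples drawn satisfies $$m\le K\cdot\frac{1}{\alpha^3\epsilon^2}\ln\Big(\frac k\delta\Big)\Big((d+k)\ln\Big(\frac1\epsilon\Big)+\ln\Big(\frac1\delta\Big)\Big).$$ -/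

import Mathlib

open MeasureTheory ProbabilityTheory

noncomputable section

namespace CollabPAC

/-- Labelled samples of size `n` (ordered, repetitions allowed). -/
abbrev Sample (X : Type*) (n : ℕ) : Type _ := Fin n → X × Bool

/-- `err_D(f) = Pr_{(x,y) ∼ D} [f x ≠ y]`. -/
def err {X : Type*} [MeasurableSpace X] (D : Measure (X × Bool)) (f : X → Bool) : ℝ :=
  D.real {z | f z.1 ≠ z.2}

/-- `err_S(f)`: the fraction of the sample points that `f` mislabels. -/
def empErr {X : Type*} {n : ℕ} (S : Sample X n) (f : X → Bool) : ℝ :=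
  ((Finset.univ.filter fun j => f (S j).1 ≠ (S j).2).card : ℝ) / n

/-- `OPT = inf_{f ∈ F} max_{i} err_{D_i}(f)`. -/
def opt {X : Type*} [MeasurableSpace X] {k : ℕ} (D : Fin k → Measure (X × Bool))
    (F : Set (X → Bool)) : ℝ :=
  ⨅ f : F, ⨆ i : Fin k, err (D i) f

/-- `F` realises every labelling of the finite set `s`. -/
def Shatters {X : Type*} (F : Set (X → Bool)) (s : Finset X) : Prop :=
  ∀ g : X → Bool, ∃ f ∈ F, ∀ x ∈ s, f x = g x

/-- VC dimension: the supremum of the sizes of the finite sets shattered by `F`. -/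
def vcDim {X : Type*} (F : Set (X → Bool)) : ℕ∞ :=
  ⨆ s : {s : Finset X // Shatters F s}, (s.1.card : ℕ∞)

/-- `O` maps every sample to a member of `F` with minimal error on that sample. -/
def IsERM {X : Type*} (F : Set (X → Bool)) (O : ∀ n : ℕ, Sample X n → X → Bool) : Prop :=
  ∀ (n : ℕ) (S : Sample X n), O n S ∈ F ∧ ∀ f ∈ F, empErr S (O n S) ≤ empErr S f

/-- The samples drawn in one round: `S` (of size `nS`) from the weighted mixture, and, for each
of the `k` players, `T i` (of size `nT`) from the distribution of player `i`. -/
abbrev RoundData (X : Type*) (k nS nT : ℕ) : Type _ := Sample X nS × (Fin k → Sample X nT)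

/-- The weighted mixture `(1 / ∑ i, w i) • ∑ i, w i • D i`. -/
def mixture {X : Type*} [MeasurableSpace X] {k : ℕ} (D : Fin k → Measure (X × Bool))
    (w : Fin k → ℝ) : Measure (X × Bool) :=
  ∑ i, ENNReal.ofReal (w i / ∑ j, w j) • D i

section Algorithm

variable {X : Type*} {k nS nT : ℕ}

/-- The classifier of a round: the oracle applied to the sample from the mixture. -/
def roundClassifier (O : ∀ n : ℕ, Sample X n → X → Bool) (ρ : RoundData X k nS nT) : X → Bool :=
  O nS ρ.1

/-- The increment `s_i` of a round, where `a = α'` and `e = ε'`. -/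
def increment (O : ∀ n : ℕ, Sample X n → X → Bool) (a e : ℝ) (ρ : RoundData X k nS nT)
    (i : Fin k) : ℝ :=
  empErr (ρ.2 i) (roundClassifier O ρ) * e * a /
    ((1 + 3 * a) * empErr ρ.1 (roundClassifier O ρ) + 3 * e)

/-- The weights after the rounds recorded in `h`. -/
def weight (O : ∀ n : ℕ, Sample X n → X → Bool) (a e : ℝ) :
    (r : ℕ) → (Fin r → RoundData X k nS nT) → Fin k → ℝ
  | 0, _, _ => 1
  | r + 1, h, i => weight O a e r (Fin.init h) i * (1 + increment O a e (h (Fin.last r)) i)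

variable [MeasurableSpace X]

/-- The law of the samples of the next round, given the rounds recorded in `h`: all samples are
independent, those in `S` are drawn from the mixture with the current weights, and those in `T i`
are drawn from `D i`. -/
def roundLaw (D : Fin k → Measure (X × Bool)) (O : ∀ n : ℕ, Sample X n → X → Bool) (a e : ℝ)
    (r : ℕ) (h : Fin r → RoundData X k nS nT) : Measure (RoundData X k nS nT) :=
  (Measure.pi fun _ : Fin nS => mixture D (weight O a e r h)).prod
    (Measure.pi fun i : Fin k => Measure.pi fun _ : Fin nT => D i)

/-- The joint law of the samples drawn in the first `r` rounds. -/
def runLaw (D : Fin k → Measure (X × Bool)) (O : ∀ n : ℕ, Sample X n → X → Bool) (a e : ℝ) :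
    (r : ℕ) → Measure (Fin r → RoundData X k nS nT)
  | 0 => Measure.dirac Fin.elim0
  | r + 1 => (runLaw D O a e r).bind fun h =>
      (roundLaw D O a e r h).map fun ρ => Fin.snoc (α := fun _ => RoundData X k nS nT) h ρ

end Algorithm

/-- The randomized classifier that, given `x`, picks one of `f 0, …, f (t - 1)` uniformly at
random and returns its label of `x`: the value at `x` is the law of the returned label. -/
def mixClassifier {X : Type*} {t : ℕ} (f : Fin t → X → Bool) (x : X) : Measure Bool :=
  (uniformOn (Set.univ : Set (Fin t))).map fun r => f r x

/-- The error probability of a randomized classifier `g`, over both the random example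
`(x, y) ∼ D` and the random label drawn from `g x`. -/
def expectedErr {X : Type*} [MeasurableSpace X] (D : Measure (X × Bool)) (g : X → Measure Bool) :
    ℝ :=
  (∫⁻ z, g z.1 {b | b ≠ z.2} ∂D).toReal

/-- `α' = α / 15`. -/
def innerAlpha (α : ℝ) : ℝ := α / 15

/-- `ε' = ε / 29`. -/
def innerEps (ε : ℝ) : ℝ := ε / 29

/-- The number of rounds `t = 2 ⌈ln (4 k / δ) / (ε' α' ^ 2)⌉`. -/
def rounds (k : ℕ) (α ε δ : ℝ) : ℕ :=
  2 * ⌈Real.log (4 * k / δ) / (innerEps ε * innerAlpha α ^ 2)⌉₊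

/-- `δ' = δ / (4 t)`. -/
def innerDelta (k : ℕ) (α ε δ : ℝ) : ℝ := δ / (4 * rounds k α ε δ)

/-- The size `(c / (α' ε')) (d ln (1 / ε') + ln (1 / δ'))` of the sample from the mixture. -/
def sizeS (c : ℝ) (d k : ℕ) (α ε δ : ℝ) : ℕ :=
  ⌈c / (innerAlpha α * innerEps ε) *
    (d * Real.log (1 / innerEps ε) + Real.log (1 / innerDelta k α ε δ))⌉₊

/-- The size `(c / (α' ε')) ln (1 / ε')` of the sample from each player. -/
def sizeT (c : ℝ) (α ε : ℝ) : ℕ :=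
  ⌈c / (innerAlpha α * innerEps ε) * Real.log (1 / innerEps ε)⌉₊

/-- The records of the complete runs of the algorithm (`cS` and `cT` are the constants in the
sizes of the samples). -/
abbrev Run (X : Type*) (cS cT : ℝ) (d k : ℕ) (α ε δ : ℝ) : Type _ :=
  Fin (rounds k α ε δ) → RoundData X k (sizeS cS d k α ε δ) (sizeT cT α ε)

/-- The law of a complete run of NR2-AVG. -/
def nr2avgLaw {X : Type*} [MeasurableSpace X] {k : ℕ} (D : Fin k → Measure (X × Bool))
    (O : ∀ n : ℕ, Sample X n → X → Bool) (cS cT : ℝ) (d : ℕ) (α ε δ : ℝ) :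
    Measure (Run X cS cT d k α ε δ) :=
  runLaw D O (innerAlpha α) (innerEps ε) (rounds k α ε δ)

/-- The randomized classifier that NR2-AVG returns at the end of a run. -/
def nr2avgOutput {X : Type*} {k d : ℕ} {cS cT α ε δ : ℝ} (O : ∀ n : ℕ, Sample X n → X → Bool)
    (h : Run X cS cT d k α ε δ) : X → Measure Bool :=
  mixClassifier fun r => roundClassifier O (h r)

/-- The number of samples that NR2-AVG draws: in each round one sample from the mixture and one
from each of the `k` players. -/
def nr2avgSamples (cS cT : ℝ) (d k : ℕ) (α ε δ : ℝ) : ℕ :=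
  rounds k α ε δ * (sizeS cS d k α ε δ + k * sizeT cT α ε)

end CollabPAC

end

open CollabPAC

/-!
Call a round accurate if the error of its classifier on the mixture is at most the denominator of
`s_i` and its empirical error is nearly optimal; by uniform convergence over classes of VC dimension
`d`, each round fails to be accurate with small probability, whatever the past was. In an accurate
round the weighted average of the expected increments `s_i` is therefore at most `ε' α'`, so the
total weight grows in expectation by a factor at most `1 + ε' α'`, whereas the weight of a player
whose classifiers have average error above the claimed bound would grow by a larger factor. Both
growth rates hold with high probability because `total weight / (1 + ε' α') ^ r` and
`exp (∑ expected increments) / weight` are, up to lower-order terms in the exponents, nonnegative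
supermartingales on the accurate runs, to which Markov's inequality applies.
-/

namespace CollabPAC

section Chernoff

variable {Z : Type*} [MeasurableSpace Z] {P : Measure Z} [IsProbabilityMeasure P] {g : Z → ℝ}

theorem integral_exp_mul_le (hg : Measurable g) (hg01 : ∀ z, g z ∈ Set.Icc (0 : ℝ) 1) {l : ℝ}
    (hl : |l| ≤ 1) : ∫ z, Real.exp (l * g z) ∂P ≤ Real.exp ((l + l ^ 2) * ∫ z, g z ∂P) := by
  have hint : Integrable g P := Integrable.of_mem_Icc 0 1 hg.aemeasurable (.of_forall hg01)
  have chord (z : Z) : Real.exp (l * g z) ≤ 1 + (Real.exp l - 1) * g z := by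
    have h := convexOn_exp.2 (Set.mem_univ 0) (Set.mem_univ l) (sub_nonneg.2 (hg01 z).2)
      (hg01 z).1 (by ring)
    simp only [smul_eq_mul, mul_zero, zero_add, Real.exp_zero] at h
    rw [mul_comm l]
    linarith
  calc ∫ z, Real.exp (l * g z) ∂P
      ≤ ∫ z, (1 + (Real.exp l - 1) * g z) ∂P :=
        integral_mono_of_nonneg (.of_forall fun _ => (Real.exp_pos _).le)
          ((integrable_const _).add (hint.const_mul _)) (.of_forall chord)
    _ = (Real.exp l - 1) * (∫ z, g z ∂P) + 1 := by
        rw [integral_add (integrable_const _) (hint.const_mul _), integral_const_mul,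
          integral_const, probReal_univ, one_smul, add_comm]
    _ ≤ (l + l ^ 2) * (∫ z, g z ∂P) + 1 := by
        gcongr
        · exact integral_nonneg fun z => (hg01 z).1
        · linarith [(abs_le.1 (Real.abs_exp_sub_one_sub_id_le hl)).2]
    _ ≤ _ := Real.add_one_le_exp _

/- The upper tail is the case `0 < l`, the lower tail the case `l < 0`. -/
theorem measureReal_pi_sum_ge_le {ι : Type*} [Fintype ι] (hg : Measurable g)
    (hg01 : ∀ z, g z ∈ Set.Icc (0 : ℝ) 1) {l : ℝ} (hl : |l| ≤ 1) (c : ℝ) :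
    (Measure.pi fun _ : ι => P).real
      {S | Fintype.card ι * ((l + l ^ 2) * (∫ z, g z ∂P) + c) ≤ l * ∑ j, g (S j)} ≤
        Real.exp (-(c * Fintype.card ι)) := by
  set μ := Measure.pi fun _ : ι => P
  have hexp (S : ι → Z) : Real.exp (1 * (l * ∑ j, g (S j))) = ∏ j, Real.exp (l * g (S j)) := by
    rw [one_mul, Finset.mul_sum, Real.exp_sum]
  have hint : Integrable (fun S : ι → Z => Real.exp (1 * (l * ∑ j, g (S j)))) μ := by
    simp only [hexp]
    refine Integrable.fintype_prod fun _ => Integrable.of_bound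
      (hg.const_mul l).exp.aestronglyMeasurable (Real.exp 1) (.of_forall fun z => ?_)
    rw [Real.norm_of_nonneg (Real.exp_pos _).le, Real.exp_le_exp]
    calc l * g z ≤ |l * g z| := le_abs_self _
      _ = |l| * g z := by rw [abs_mul, abs_of_nonneg (hg01 z).1]
      _ ≤ 1 := mul_le_one₀ hl (hg01 z).1 (hg01 z).2
  have hmgf : mgf (fun S : ι → Z => l * ∑ j, g (S j)) μ 1 ≤
      Real.exp ((l + l ^ 2) * ∫ z, g z ∂P) ^ Fintype.card ι := by
    simp only [mgf, hexp, μ]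
    rw [integral_fintype_prod_eq_pow fun z => Real.exp (l * g z)]
    exact pow_le_pow_left₀ (integral_nonneg fun _ => (Real.exp_pos _).le)
      (integral_exp_mul_le hg hg01 hl) _
  refine (measure_ge_le_exp_mul_mgf _ zero_le_one hint).trans
    ((mul_le_mul_of_nonneg_left hmgf (Real.exp_pos _).le).trans_eq ?_)
  rw [← Real.exp_nat_mul, ← Real.exp_add]
  ring_nf

end Chernoff

/-- The indicator of the event that `f` mislabels the example `z`, as a real number. -/
def mislabel {X : Type*} (f : X → Bool) (z : X × Bool) : ℝ :=
  if f z.1 ≠ z.2 then 1 else 0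

section EmpiricalErrors

variable {X : Type*} {n : ℕ}

theorem mislabel_mem_Icc (f : X → Bool) (z : X × Bool) : mislabel f z ∈ Set.Icc (0 : ℝ) 1 := by
  unfold mislabel
  split_ifs <;> simp

theorem natCast_mul_empErr (S : Sample X n) (f : X → Bool) :
    n * empErr S f = ∑ j, mislabel f (S j) := by
  rcases n.eq_zero_or_pos with rfl | hn
  · simp
  · simp only [empErr, mislabel, Finset.sum_boole]
    field_simp

theorem empErr_nonneg (S : Sample X n) (f : X → Bool) : 0 ≤ empErr S f := by
  unfold empErr
  positivity

theorem empErr_le_one (S : Sample X n) (f : X → Bool) : empErr S f ≤ 1 :=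
  div_le_one_of_le₀ (by exact_mod_cast (Finset.card_filter_le _ _).trans (by simp))
    (Nat.cast_nonneg n)

variable [MeasurableSpace X]

theorem err_nonneg (P : Measure (X × Bool)) (f : X → Bool) : 0 ≤ err P f := measureReal_nonneg

theorem measurableSet_mislabelled {Y : Type*} [MeasurableSpace Y] {G : Y → X → Bool}
    (hG : Measurable fun p : Y × X => G p.1 p.2) :
    MeasurableSet {p : Y × (X × Bool) | G p.1 p.2.1 ≠ p.2.2} :=
  (measurableSet_eq_fun (hG.comp (by fun_prop : Measurable fun p : Y × (X × Bool) => (p.1, p.2.1)))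
    (by fun_prop)).compl

theorem measurable_err {Y : Type*} [MeasurableSpace Y] {G : Y → X → Bool}
    (hG : Measurable fun p : Y × X => G p.1 p.2) (P : Measure (X × Bool)) [SFinite P] :
    Measurable fun y => err P (G y) :=
  (measurable_measure_prodMk_left (measurableSet_mislabelled hG)).ennreal_toReal

theorem measurable_sum_mislabel {Y : Type*} [MeasurableSpace Y] {G : Y → X → Bool}
    {T : Y → Sample X n} (hG : Measurable fun p : Y × X => G p.1 p.2) (hT : Measurable T) :
    Measurable fun y => ∑ j, mislabel (G y) (T y j) :=
  Finset.measurable_sum _ fun j _ =>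
    (Measurable.ite (measurableSet_mislabelled hG) measurable_const measurable_const).comp
      (measurable_id.prodMk ((measurable_pi_apply j).comp hT))

theorem measurable_empErr {Y : Type*} [MeasurableSpace Y] {G : Y → X → Bool}
    {T : Y → Sample X n} (hG : Measurable fun p : Y × X => G p.1 p.2) (hT : Measurable T) :
    Measurable fun y => empErr (T y) (G y) := by
  simp only [empErr, ← Finset.sum_boole]
  exact (measurable_sum_mislabel hG hT).div_const _

variable {f : X → Bool}

theorem measurable_mislabel (hf : Measurable f) : Measurable (mislabel f) :=
  Measurable.ite (measurableSet_eq_fun (hf.comp measurable_fst) measurable_snd).compl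
    measurable_const measurable_const

theorem integral_mislabel (P : Measure (X × Bool)) (hf : Measurable f) :
    ∫ z, mislabel f z ∂P = err P f := by
  have hmeas : MeasurableSet {z : X × Bool | f z.1 ≠ z.2} :=
    (measurableSet_eq_fun (hf.comp measurable_fst) measurable_snd).compl
  have hind : mislabel f = Set.indicator {z : X × Bool | f z.1 ≠ z.2} 1 := by
    funext z
    simp [mislabel, Set.indicator]
  rw [hind, integral_indicator_one hmeas, err]

theorem integral_empErr (hn : 0 < n) (P : Measure (X × Bool)) [IsProbabilityMeasure P]
    (hf : Measurable f) : ∫ S : Sample X n, empErr S f ∂(Measure.pi fun _ => P) = err P f := by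
  have hint : Integrable (mislabel f) P := Integrable.of_mem_Icc 0 1
    (measurable_mislabel hf).aemeasurable (.of_forall (mislabel_mem_Icc f))
  have hsum : ∫ S : Sample X n, ∑ j, mislabel f (S j) ∂(Measure.pi fun _ => P) = n * err P f := by
    rw [integral_finsetSum _ fun j _ => integrable_comp_eval (μ := fun _ : Fin n => P) hint]
    simp [integral_comp_eval (μ := fun _ : Fin n => P) hint.aestronglyMeasurable,
      integral_mislabel P hf]
  simp only [← natCast_mul_empErr, integral_const_mul] at hsum
  exact mul_left_cancel₀ (by positivity) hsum

end EmpiricalErrors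

section GrowthFunction

variable {X ι : Type*} [Fintype ι] {F : Set (X → Bool)} {d : ℕ}

theorem Shatters.card_le_vcDim {s : Finset X} (hs : Shatters F s) : (s.card : ℕ∞) ≤ vcDim F :=
  le_iSup (fun s : {s : Finset X // Shatters F s} => (s.1.card : ℕ∞)) ⟨s, hs⟩

open Classical in
/-- The trace of `F` on the points `z i`: the sets of the indices of the points that some classifier
in `F` labels `true`. Its cardinality is what the growth function of `F` bounds. -/
noncomputable def traces (F : Set (X → Bool)) (z : ι → X) : Finset (Finset ι) :=
  {s | ∃ f ∈ F, ∀ i, i ∈ s ↔ f (z i) = true}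

theorem mem_traces {z : ι → X} {s : Finset ι} :
    s ∈ traces F z ↔ ∃ f ∈ F, ∀ i, i ∈ s ↔ f (z i) = true := by
  simp [traces]

theorem exists_mem_of_shatters_traces [DecidableEq ι] {z : ι → X} {s t : Finset ι}
    (hs : (traces F z).Shatters s) (ht : t ⊆ s) :
    ∃ f ∈ F, ∀ i ∈ s, (f (z i) = true ↔ i ∈ t) := by
  obtain ⟨u, hu, rfl⟩ := hs ht
  obtain ⟨f, hf, hfu⟩ := mem_traces.1 hu
  exact ⟨f, hf, fun i hi => by simp [hi, hfu]⟩

theorem card_le_vcDim_of_shatters_traces [DecidableEq ι] {z : ι → X} {s : Finset ι}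
    (hs : (traces F z).Shatters s) : (s.card : ℕ∞) ≤ vcDim F := by
  classical
  have hinj : Set.InjOn z s := by
    intro i hi j hj hij
    obtain ⟨f, -, h⟩ := exists_mem_of_shatters_traces hs (Finset.singleton_subset_iff.2 hi)
    have hj' := (h j hj).1 (hij ▸ (h i hi).2 (Finset.mem_singleton_self i))
    exact (Finset.mem_singleton.1 hj').symm
  have himage : Shatters F (s.image z) := by
    intro g
    obtain ⟨f, hf, h⟩ := exists_mem_of_shatters_traces hs
      (Finset.filter_subset (fun i => g (z i) = true) s)
    refine ⟨f, hf, Finset.forall_mem_image.2 fun i hi => Bool.eq_iff_iff.2 ?_⟩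
    simpa [hi] using h i hi
  simpa only [Finset.card_image_of_injOn hinj] using himage.card_le_vcDim

theorem card_traces_le (hd : vcDim F ≤ d) (z : ι → X) :
    (traces F z).card ≤ ∑ i ∈ Finset.Iic d, (Fintype.card ι).choose i := by
  classical
  have hvc : (traces F z).vcDim ≤ d := Finset.sup_le fun s hs => by
    exact_mod_cast (card_le_vcDim_of_shatters_traces (Finset.mem_shatterer.1 hs)).trans hd
  calc (traces F z).card ≤ (traces F z).shatterer.card := Finset.card_le_card_shatterer _
    _ ≤ ∑ i ∈ Finset.Iic (traces F z).vcDim, (Fintype.card ι).choose i :=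
        Finset.card_shatterer_le_sum_vcDim
    _ ≤ _ := Finset.sum_le_sum_of_subset (Finset.Iic_subset_Iic.2 hvc)

end GrowthFunction

theorem sum_choose_le_exp (d m : ℕ) {x : ℝ} (hx : 0 < x) (hx1 : x ≤ 1) :
    ∑ i ∈ Finset.Iic d, (m.choose i : ℝ) ≤ (1 / x) ^ d * Real.exp (x * m) := by
  have hpow : x ^ d * ∑ i ∈ Finset.Iic d, (m.choose i : ℝ) ≤ (x + 1) ^ m :=
    calc x ^ d * ∑ i ∈ Finset.Iic d, (m.choose i : ℝ)
        = ∑ i ∈ Finset.Iic d, x ^ d * (m.choose i : ℝ) := Finset.mul_sum _ _ _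
      _ ≤ ∑ i ∈ Finset.Iic d, x ^ i * (m.choose i : ℝ) := by
          refine Finset.sum_le_sum fun i hi => ?_
          gcongr ?_ * _
          exact pow_le_pow_of_le_one hx.le hx1 (Finset.mem_Iic.1 hi)
      _ ≤ ∑ i ∈ Finset.Iic d ∪ Finset.range (m + 1), x ^ i * (m.choose i : ℝ) :=
          Finset.sum_le_sum_of_subset_of_nonneg Finset.subset_union_left
            fun _ _ _ => by positivity
      _ = ∑ i ∈ Finset.range (m + 1), x ^ i * (m.choose i : ℝ) := by
          refine (Finset.sum_subset Finset.subset_union_right fun i _ hi => ?_).symm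
          rw [Nat.choose_eq_zero_of_lt (by simpa using hi), Nat.cast_zero, mul_zero]
      _ = (x + 1) ^ m := by simp only [add_pow, one_pow, mul_one]
  calc ∑ i ∈ Finset.Iic d, (m.choose i : ℝ)
      = (1 / x) ^ d * (x ^ d * ∑ i ∈ Finset.Iic d, (m.choose i : ℝ)) := by
        rw [← mul_assoc, ← mul_pow, one_div_mul_cancel hx.ne', one_pow, one_mul]
    _ ≤ (1 / x) ^ d * (x + 1) ^ m := by gcongr
    _ ≤ (1 / x) ^ d * Real.exp x ^ m := by gcongr; exact Real.add_one_le_exp x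
    _ = (1 / x) ^ d * Real.exp (x * m) := by rw [← Real.exp_nat_mul, mul_comm x]

theorem exists_finset_agree {X ι : Type*} [Fintype ι] {F : Set (X → Bool)} {d : ℕ}
    (hd : vcDim F ≤ d) (z : ι → X) {x : ℝ} (hx : 0 < x) (hx1 : x ≤ 1) :
    ∃ R : Finset (X → Bool), (∀ f ∈ F, ∃ g ∈ R, ∀ i, f (z i) = g (z i)) ∧
      (R.card : ℝ) ≤ (1 / x) ^ d * Real.exp (x * Fintype.card ι) := by
  classical
  choose! g hg using fun (s : Finset ι) (hs : s ∈ traces F z) => mem_traces.1 hs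
  refine ⟨(traces F z).image g, fun f hf => ?_, ?_⟩
  · have hs : ({i | f (z i) = true} : Finset ι) ∈ traces F z := mem_traces.2 ⟨f, hf, by simp⟩
    exact ⟨_, Finset.mem_image_of_mem g hs, fun i =>
      Bool.eq_iff_iff.2 (by simpa using (hg _ hs).2 i)⟩
  · refine le_trans ?_ (sum_choose_le_exp d (Fintype.card ι) hx hx1)
    exact_mod_cast Finset.card_image_le.trans (card_traces_le hd z)

section RandomSwaps

variable {ι Z : Type*}

/-- The pair `p` of sequences with the entries at the places marked by `σ` exchanged; the random
swaps of the symmetrization argument. -/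
def swapAt (σ : ι → Bool) (p : (ι → Z) × (ι → Z)) : (ι → Z) × (ι → Z) :=
  (fun j => if σ j then p.2 j else p.1 j, fun j => if σ j then p.1 j else p.2 j)

theorem measurePreserving_swapAt [Fintype ι] [MeasurableSpace Z] (μ : ι → Measure Z)
    [∀ j, SigmaFinite (μ j)] (σ : ι → Bool) :
    MeasurePreserving (swapAt σ) ((Measure.pi μ).prod (Measure.pi μ))
      ((Measure.pi μ).prod (Measure.pi μ)) := by
  have hpairs := measurePreserving_arrowProdEquivProdArrow Z Z ι μ μ
  have hswap : MeasurePreserving (fun (ω : ι → Z × Z) j => if σ j then (ω j).swap else ω j)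
      (Measure.pi fun j => (μ j).prod (μ j)) (Measure.pi fun j => (μ j).prod (μ j)) := by
    refine measurePreserving_pi _ _
      (f := fun j (z : Z × Z) => if σ j then z.swap else z) fun j => ?_
    cases σ j
    · exact MeasurePreserving.id _
    · exact Measure.measurePreserving_swap
  convert hpairs.comp (hswap.comp hpairs.symm) using 1
  funext p
  refine Prod.ext (funext fun j => ?_) (funext fun j => ?_) <;>
    · by_cases hj : σ j <;> simp [swapAt, hj, MeasurableEquiv.arrowProdEquivProdArrow]

theorem measureReal_le_of_sum_indicator_le {κ Ω : Type*} [Fintype κ] [Nonempty κ]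
    [MeasurableSpace Ω] {μ : Measure Ω} [IsProbabilityMeasure μ] {T : κ → Ω → Ω}
    (hT : ∀ σ, MeasurePreserving (T σ) μ μ) {E : Set Ω} (hE : MeasurableSet E) {c : ℝ}
    (hc : ∀ ω, ∑ σ, E.indicator (1 : Ω → ℝ) (T σ ω) ≤ Fintype.card κ * c) : μ.real E ≤ c := by
  have hint (σ : κ) : Integrable (fun ω => E.indicator (1 : Ω → ℝ) (T σ ω)) μ :=
    (hT σ).integrable_comp_of_integrable ((integrable_const 1).indicator hE)
  have heq (σ : κ) : ∫ ω, E.indicator (1 : Ω → ℝ) (T σ ω) ∂μ = μ.real E := by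
    exact (integral_indicator_one ((hT σ).measurable hE)).trans
      ((hT σ).measureReal_preimage hE.nullMeasurableSet)
  have hcard : (Fintype.card κ : ℝ) * μ.real E ≤ Fintype.card κ * c :=
    calc (Fintype.card κ : ℝ) * μ.real E
        = ∫ ω, ∑ σ, E.indicator (1 : Ω → ℝ) (T σ ω) ∂μ := by
          rw [integral_finsetSum _ fun σ _ => hint σ]
          simp [heq]
      _ ≤ ∫ _, Fintype.card κ * c ∂μ :=
          integral_mono (integrable_finsetSum _ fun σ _ => hint σ) (integrable_const _) hc
      _ = Fintype.card κ * c := by simp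
  exact le_of_mul_le_mul_left hcard (by exact_mod_cast Fintype.card_pos)

theorem exp_add_exp_swap_le {a u v : ℝ} (ha : 0 < a) (ha1 : a ≤ 1 / 2) (hu : u ∈ Set.Icc 0 1)
    (hv : v ∈ Set.Icc 0 1) :
    Real.exp (a / 4 * (u - (1 + a) * v)) + Real.exp (a / 4 * (v - (1 + a) * u)) ≤ 2 := by
  have quad {x y : ℝ} (hx : x ∈ Set.Icc 0 1) (hy : y ∈ Set.Icc 0 1) :
      Real.exp (a / 4 * (x - (1 + a) * y)) ≤
        1 + a / 4 * (x - (1 + a) * y) + (a / 4 * (x - (1 + a) * y)) ^ 2 := by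
    obtain ⟨hx0, hx1⟩ := hx
    obtain ⟨hy0, hy1⟩ := hy
    have habs : |a / 4 * (x - (1 + a) * y)| ≤ 1 := by
      rw [abs_le]
      constructor <;> nlinarith [mul_nonneg ha.le hy0, mul_nonneg ha.le hx0]
    linarith [(abs_le.1 (Real.abs_exp_sub_one_sub_id_le habs)).2]
  -- The linear terms add up to `-a² (u + v) / 4`, which pays for the squares.
  have hsq : (u - (1 + a) * v) ^ 2 + (v - (1 + a) * u) ^ 2 ≤ 4 * (u + v) := by
    obtain ⟨hu0, hu1⟩ := hu
    obtain ⟨hv0, hv1⟩ := hv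
    have hfactor : (1 + a) ^ 2 ≤ 3 := by nlinarith
    nlinarith [mul_nonneg (sub_nonneg.2 hfactor) (add_nonneg hu0 hv0),
      mul_nonneg (sq_nonneg (1 + a)) (add_nonneg (mul_nonneg hu0 (sub_nonneg.2 hu1))
        (mul_nonneg hv0 (sub_nonneg.2 hv1))),
      mul_nonneg ha.le (mul_nonneg hu0 hv0), mul_nonneg hu0 hv0,
      mul_nonneg hu0 (sub_nonneg.2 hu1), mul_nonneg hv0 (sub_nonneg.2 hv1)]
  nlinarith [quad hu hv, quad hv hu, mul_le_mul_of_nonneg_left hsq (sq_nonneg (a / 4))]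

theorem sum_exp_swapAt_le [Fintype ι] {a : ℝ} (ha : 0 < a) (ha1 : a ≤ 1 / 2)
    {p : (ι → ℝ) × (ι → ℝ)} (hp₁ : ∀ j, p.1 j ∈ Set.Icc (0 : ℝ) 1)
    (hp₂ : ∀ j, p.2 j ∈ Set.Icc (0 : ℝ) 1) [DecidableEq ι] :
    ∑ σ : ι → Bool, Real.exp (a / 4 *
      (∑ j, (swapAt σ p).2 j - (1 + a) * ∑ j, (swapAt σ p).1 j)) ≤ 2 ^ Fintype.card ι := by
  have hprod (σ : ι → Bool) : Real.exp (a / 4 *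
      (∑ j, (swapAt σ p).2 j - (1 + a) * ∑ j, (swapAt σ p).1 j)) =
      ∏ j, Real.exp (a / 4 * ((if σ j then p.1 j else p.2 j) -
        (1 + a) * (if σ j then p.2 j else p.1 j))) := by
    rw [← Real.exp_sum, Finset.mul_sum, ← Finset.sum_sub_distrib, Finset.mul_sum]
    rfl
  rw [Finset.sum_congr rfl fun σ _ => hprod σ, ← Fintype.prod_sum fun j (b : Bool) =>
    Real.exp (a / 4 * ((if b then p.1 j else p.2 j) - (1 + a) * (if b then p.2 j else p.1 j)))]
  calc _ ≤ ∏ _j : ι, (2 : ℝ) := by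
        refine Finset.prod_le_prod (fun j _ => by positivity) fun j _ => ?_
        simpa using exp_add_exp_swap_le ha ha1 (hp₁ j) (hp₂ j)
    _ = 2 ^ Fintype.card ι := by simp

end RandomSwaps

section UniformConvergence

variable {X : Type*} {n d : ℕ} {F : Set (X → Bool)} {G : Sample X n → X → Bool} {a e : ℝ}

/-- The number of errors of `g` on the second half of a double sample, minus `1 + a` times the
number of its errors on the first half. -/
def excessErr (a : ℝ) (g : X → Bool) (p : Sample X n × Sample X n) : ℝ :=
  ∑ j, mislabel g (p.2 j) - (1 + a) * ∑ j, mislabel g (p.1 j)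

/-- The double samples on whose second half the classifier that `G` chooses from the first half does
markedly worse than on the first half. -/
def gapSet (G : Sample X n → X → Bool) (a e : ℝ) : Set (Sample X n × Sample X n) :=
  {p | e * n ≤ excessErr a (G p.1) p}

theorem excessErr_swapAt_congr {f g : X → Bool} {p : Sample X n × Sample X n}
    (h₁ : ∀ j, f (p.1 j).1 = g (p.1 j).1) (h₂ : ∀ j, f (p.2 j).1 = g (p.2 j).1)
    (σ : Fin n → Bool) : excessErr a f (swapAt σ p) = excessErr a g (swapAt σ p) := by
  simp only [excessErr, swapAt, mislabel, apply_ite Prod.fst, apply_ite f, apply_ite g, h₁, h₂]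

theorem sum_exp_excessErr_swapAt_le (ha : 0 < a) (ha1 : a ≤ 1 / 2) (g : X → Bool)
    (p : Sample X n × Sample X n) :
    ∑ σ : Fin n → Bool, Real.exp (a / 4 * excessErr a g (swapAt σ p)) ≤ 2 ^ n := by
  simpa only [Fintype.card_fin, excessErr, swapAt, apply_ite (mislabel g)] using
    sum_exp_swapAt_le ha ha1 (p := (fun j => mislabel g (p.1 j), fun j => mislabel g (p.2 j)))
      (fun _ => mislabel_mem_Icc _ _) fun _ => mislabel_mem_Icc _ _

/-- Only the finitely many patterns that `F` realises on the points of `p` matter, so that a union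
bound over fixed classifiers replaces the choice `G`. -/
theorem sum_indicator_gapSet_swapAt_le (hd : vcDim F ≤ d) (hF : ∀ S, G S ∈ F) (ha : 0 < a)
    (ha1 : a ≤ 1 / 2) {x : ℝ} (hx : 0 < x) (hx1 : x ≤ 1) (p : Sample X n × Sample X n) :
    ∑ σ : Fin n → Bool,
        (gapSet G a e).indicator (1 : Sample X n × Sample X n → ℝ) (swapAt σ p) ≤
      2 ^ n * ((1 / x) ^ d * Real.exp (2 * x * n) * Real.exp (-(a / 4 * (e * n)))) := by
  obtain ⟨R, hR, hcard⟩ := exists_finset_agree hd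
    (Sum.elim (fun j => (p.1 j).1) fun j => (p.2 j).1) hx hx1
  rw [Fintype.card_sum, Fintype.card_fin, Nat.cast_add, ← two_mul, mul_left_comm,
    ← mul_assoc] at hcard
  have hind (σ : Fin n → Bool) :
      (gapSet G a e).indicator (1 : Sample X n × Sample X n → ℝ) (swapAt σ p) ≤
        ∑ g ∈ R, Real.exp (a / 4 * excessErr a g (swapAt σ p)) *
          Real.exp (-(a / 4 * (e * n))) := by
    refine Set.indicator_apply_le' (fun hσ => ?_) fun _ => by positivity
    obtain ⟨g, hg, hfg⟩ := hR _ (hF (swapAt σ p).1)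
    have hgap : e * n ≤ excessErr a g (swapAt σ p) :=
      hσ.trans_eq (excessErr_swapAt_congr (fun j => hfg (.inl j)) (fun j => hfg (.inr j)) σ)
    refine le_trans ?_ (Finset.single_le_sum (f := fun g =>
      Real.exp (a / 4 * excessErr a g (swapAt σ p)) * Real.exp (-(a / 4 * (e * n))))
      (fun _ _ => by positivity) hg)
    rw [Pi.one_apply, ← Real.exp_add, Real.one_le_exp_iff, ← sub_eq_add_neg, ← mul_sub]
    exact mul_nonneg (by positivity) (sub_nonneg.2 hgap)
  calc _ ≤ ∑ σ, ∑ g ∈ R, Real.exp (a / 4 * excessErr a g (swapAt σ p)) *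
          Real.exp (-(a / 4 * (e * n))) := Finset.sum_le_sum fun σ _ => hind σ
    _ = ∑ g ∈ R, (∑ σ, Real.exp (a / 4 * excessErr a g (swapAt σ p))) *
          Real.exp (-(a / 4 * (e * n))) := by
        rw [Finset.sum_comm]
        simp only [Finset.sum_mul]
    _ ≤ ∑ _g ∈ R, 2 ^ n * Real.exp (-(a / 4 * (e * n))) := by
        gcongr with g
        exact sum_exp_excessErr_swapAt_le ha ha1 g p
    _ = R.card * (2 ^ n * Real.exp (-(a / 4 * (e * n)))) := by rw [Finset.sum_const, nsmul_eq_mul]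
    _ ≤ (1 / x) ^ d * Real.exp (2 * x * n) * (2 ^ n * Real.exp (-(a / 4 * (e * n)))) := by gcongr
    _ = _ := mul_left_comm _ _ _

variable [MeasurableSpace X]

theorem measurableSet_gapSet (hG : Measurable fun p : Sample X n × X => G p.1 p.2) :
    MeasurableSet (gapSet G a e) := by
  have hG' : Measurable fun p : (Sample X n × Sample X n) × X => G p.1.1 p.2 :=
    hG.comp (by fun_prop : Measurable fun p : (Sample X n × Sample X n) × X => (p.1.1, p.2))
  exact measurableSet_le measurable_const ((measurable_sum_mislabel hG' measurable_snd).sub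
    ((measurable_sum_mislabel hG' measurable_fst).const_mul _))

theorem measureReal_gapSet_le (hd : vcDim F ≤ d) (hF : ∀ S, G S ∈ F)
    (hG : Measurable fun p : Sample X n × X => G p.1 p.2) (ha : 0 < a) (ha1 : a ≤ 1 / 2)
    (he : 0 < e) (he1 : e ≤ 1) (P : Measure (X × Bool)) [IsProbabilityMeasure P] :
    ((Measure.pi fun _ : Fin n => P).prod (Measure.pi fun _ => P)).real (gapSet G a e) ≤
      (16 / (a * e)) ^ d * Real.exp (-(a * e * n / 8)) := by
  have hbound := measureReal_le_of_sum_indicator_le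
    (measurePreserving_swapAt fun _ : Fin n => P) (measurableSet_gapSet (a := a) (e := e) hG)
    (c := (1 / (a * e / 16)) ^ d * Real.exp (2 * (a * e / 16) * n) *
      Real.exp (-(a / 4 * (e * n)))) fun p => by
        simpa using sum_indicator_gapSet_swapAt_le hd hF ha ha1 (x := a * e / 16) (by positivity)
          (by nlinarith) p
  rw [one_div_div, mul_assoc, ← Real.exp_add] at hbound
  convert hbound using 3
  ring

theorem mul_measure_le_prod_of_forall {Ω Ω' : Type*} [MeasurableSpace Ω] [MeasurableSpace Ω']
    (μ : Measure Ω) (ν : Measure Ω') [SFinite ν] {E : Set (Ω × Ω')} (hE : MeasurableSet E)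
    {B : Set Ω} (hB : MeasurableSet B) {c : ENNReal} (hc : ∀ ω ∈ B, c ≤ ν (Prod.mk ω ⁻¹' E)) :
    c * μ B ≤ (μ.prod ν) E :=
  calc c * μ B = ∫⁻ _ in B, c ∂μ := (setLIntegral_const _ _).symm
    _ ≤ ∫⁻ ω in B, ν (Prod.mk ω ⁻¹' E) ∂μ := setLIntegral_mono' hB hc
    _ ≤ ∫⁻ ω, ν (Prod.mk ω ⁻¹' E) ∂μ := setLIntegral_le_lintegral _ _
    _ = (μ.prod ν) E := (Measure.prod_apply hE).symm

theorem inv_two_le_measure_preimage_gapSet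
    (hG : Measurable fun p : Sample X n × X => G p.1 p.2) (ha : 0 < a) (ha1 : a ≤ 1 / 3)
    (he : 0 < e) (hne : 1 ≤ a * e * n) (P : Measure (X × Bool)) [IsProbabilityMeasure P]
    {S : Sample X n} (hS : (1 + 3 * a) * empErr S (G S) + 3 * e < err P (G S)) :
    (2 : ENNReal)⁻¹ ≤ (Measure.pi fun _ : Fin n => P) (Prod.mk S ⁻¹' gapSet G a e) := by
  set μ := Measure.pi fun _ : Fin n => P
  have hmeas : MeasurableSet (Prod.mk S ⁻¹' gapSet G a e) :=
    measurable_prodMk_left (measurableSet_gapSet hG)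
  have hcompl : μ.real (Prod.mk S ⁻¹' gapSet G a e)ᶜ ≤ 1 / 2 := by
    have hchernoff := measureReal_pi_sum_ge_le (P := P) (ι := Fin n)
      (measurable_mislabel hG.of_uncurry_left) (mislabel_mem_Icc (G S)) (l := -a)
      (by rw [abs_neg, abs_of_pos ha]; linarith) (a * e)
    refine (measureReal_mono fun S' hS' => ?_).trans (hchernoff.trans ?_)
    · simp only [gapSet, excessErr, Set.mem_compl_iff, Set.mem_preimage, Set.mem_ofPred_eq, not_le,
        ← natCast_mul_empErr, integral_mislabel P hG.of_uncurry_left, Fintype.card_fin] at hS' ⊢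
      have hn : (0 : ℝ) < n := pos_of_mul_pos_right (zero_lt_one.trans_le hne) (by positivity)
      have hfresh : empErr S' (G S) ≤ (1 + a) * empErr S (G S) + e :=
        le_of_mul_le_mul_left (by linarith) hn
      have hgap : empErr S' (G S) ≤ (1 - a) * err P (G S) - e := by
        nlinarith [mul_nonneg (mul_nonneg ha.le (by linarith : 0 ≤ 1 - 3 * a))
          (empErr_nonneg S (G S)), mul_nonneg he.le (by linarith : 0 ≤ 1 - 3 * a),
          mul_nonneg (by linarith : 0 ≤ 1 - a) (sub_nonneg.2 hS.le)]
      linarith [mul_le_mul_of_nonneg_left hgap (mul_pos ha hn).le]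
    · rw [Fintype.card_fin]
      linarith [Real.exp_le_exp.2 (neg_le_neg hne), Real.exp_neg_one_lt_half]
  have hhalf : (1 / 2 : ℝ) ≤ μ.real (Prod.mk S ⁻¹' gapSet G a e) := by
    rw [measureReal_compl hmeas, probReal_univ] at hcompl
    linarith
  rw [← ENNReal.ofReal_toReal (measure_ne_top μ _), ← ENNReal.ofReal_ofNat,
    ← ENNReal.ofReal_inv_of_pos two_pos]
  exact ENNReal.ofReal_le_ofReal (by rwa [← one_div])

theorem measureReal_err_gt_le (hd : vcDim F ≤ d) (hF : ∀ S, G S ∈ F)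
    (hG : Measurable fun p : Sample X n × X => G p.1 p.2) (ha : 0 < a) (ha1 : a ≤ 1 / 3)
    (he : 0 < e) (he1 : e ≤ 1) (hne : 1 ≤ a * e * n) (P : Measure (X × Bool))
    [IsProbabilityMeasure P] :
    (Measure.pi fun _ : Fin n => P).real
        {S | (1 + 3 * a) * empErr S (G S) + 3 * e < err P (G S)} ≤
      2 * (16 / (a * e)) ^ d * Real.exp (-(a * e * n / 8)) := by
  set μ := Measure.pi fun _ : Fin n => P
  set B := {S : Sample X n | (1 + 3 * a) * empErr S (G S) + 3 * e < err P (G S)}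
  have hB : MeasurableSet B := measurableSet_lt
    (((measurable_empErr hG measurable_id).const_mul _).add_const _) (measurable_err hG P)
  have hhalf := mul_measure_le_prod_of_forall μ μ (measurableSet_gapSet hG) hB fun S hS =>
    inv_two_le_measure_preimage_gapSet hG ha ha1 he hne P hS
  have hreal := ENNReal.toReal_mono (measure_ne_top _ _) hhalf
  rw [ENNReal.toReal_mul, ENNReal.toReal_inv, ENNReal.toReal_ofNat] at hreal
  have hgap := measureReal_gapSet_le hd hF hG ha (by linarith) he he1 P
  simp only [measureReal_def] at hgap ⊢
  linarith

end UniformConvergence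

section AdaptiveSampling

variable {Z : Type*}

/-- The histories of length `r` in which every point belongs to its target set, where `G r h` is
the target set for the next point after the history `h`. -/
def allRounds (G : ∀ r, (Fin r → Z) → Set Z) : ∀ r, Set (Fin r → Z)
  | 0 => Set.univ
  | r + 1 => {h | Fin.init h ∈ allRounds G r ∧ h (Fin.last r) ∈ G r (Fin.init h)}

variable {G : ∀ r, (Fin r → Z) → Set Z} {r : ℕ}

theorem snoc_mem_allRounds {h : Fin r → Z} {ρ : Z} :
    Fin.snoc (α := fun _ => Z) h ρ ∈ allRounds G (r + 1) ↔ h ∈ allRounds G r ∧ ρ ∈ G r h := by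
  simp [allRounds]

theorem apply_of_mem_allRounds {p : Z → Prop} (hp : ∀ r h, ∀ ρ ∈ G r h, p ρ) {h : Fin r → Z}
    (hh : h ∈ allRounds G r) (j : Fin r) : p (h j) := by
  induction r with
  | zero => exact j.elim0
  | succ r ih => exact Fin.lastCases (hp r _ _ hh.2) (fun j => ih hh.1 j) j

variable [MeasurableSpace Z]

/-- The law of the first `r` of a sequence of random points of `Z`, each drawn from a distribution
that depends on its predecessors: `L r h` is the law of the next point after the history `h`. -/
noncomputable def adaptiveLaw (L : ∀ r, (Fin r → Z) → Measure Z) : ∀ r, Measure (Fin r → Z)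
  | 0 => Measure.dirac Fin.elim0
  | r + 1 => (adaptiveLaw L r).bind fun h =>
      (L r h).map fun ρ => Fin.snoc (α := fun _ => Z) h ρ

variable {L : ∀ r, (Fin r → Z) → Measure Z}

theorem measurable_snoc (r : ℕ) :
    Measurable fun p : (Fin r → Z) × Z => Fin.snoc (α := fun _ => Z) p.1 p.2 := by
  refine measurable_pi_iff.2 fun j => ?_
  refine Fin.lastCases ?_ (fun j => ?_) j
  · simpa only [Fin.snoc_last] using measurable_snd
  · simp only [Fin.snoc_castSucc]
    exact (measurable_pi_apply j).comp measurable_fst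

theorem measurable_snoc_left (h : Fin r → Z) :
    Measurable fun ρ : Z => Fin.snoc (α := fun _ => Z) h ρ :=
  (measurable_snoc r).comp measurable_prodMk_left

theorem measurable_init (r : ℕ) :
    Measurable fun h : Fin (r + 1) → Z => (Fin.init h : Fin r → Z) :=
  measurable_pi_iff.2 fun j => measurable_pi_apply j.castSucc

theorem measurableSet_allRounds
    (hG : ∀ r, MeasurableSet {p : (Fin r → Z) × Z | p.2 ∈ G r p.1}) (r : ℕ) :
    MeasurableSet (allRounds G r) := by
  induction r with
  | zero => exact MeasurableSet.univ
  | succ r ih =>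
    have hlast : Measurable fun h : Fin (r + 1) → Z => ((Fin.init h : Fin r → Z), h (Fin.last r)) :=
      (measurable_init r).prodMk (measurable_pi_apply (Fin.last r))
    exact (measurable_init r ih).inter (hlast (hG r))

theorem lintegral_adaptiveLaw_succ_le (φ : (Fin (r + 1) → Z) → ENNReal) :
    ∫⁻ h, φ h ∂(adaptiveLaw L (r + 1)) ≤
      ∫⁻ h, ∫⁻ ρ, φ (Fin.snoc (α := fun _ => Z) h ρ) ∂(L r h) ∂(adaptiveLaw L r) :=
  (Measure.lintegral_bind_le _ _ _).trans (lintegral_mono fun _ => lintegral_map_le _ _)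

theorem lintegral_adaptiveLaw_le {φ : ∀ r, (Fin r → Z) → ENNReal} {β : ENNReal} (hβ : β ≠ ⊤)
    (hφ : ∀ r h, ∫⁻ ρ, φ (r + 1) (Fin.snoc (α := fun _ => Z) h ρ) ∂(L r h) ≤ β * φ r h) (r : ℕ) :
    ∫⁻ h, φ r h ∂(adaptiveLaw L r) ≤ β ^ r * φ 0 Fin.elim0 := by
  induction r with
  | zero =>
    have hφ0 : ∀ h, φ 0 h = φ 0 Fin.elim0 := fun h => by rw [Subsingleton.elim h Fin.elim0]
    simp [adaptiveLaw, hφ0]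
  | succ r ih =>
    calc ∫⁻ h, φ (r + 1) h ∂(adaptiveLaw L (r + 1))
        ≤ _ := lintegral_adaptiveLaw_succ_le _
      _ ≤ ∫⁻ h, β * φ r h ∂(adaptiveLaw L r) := lintegral_mono fun h => hφ r h
      _ = β * ∫⁻ h, φ r h ∂(adaptiveLaw L r) := lintegral_const_mul' _ _ hβ
      _ ≤ β ^ (r + 1) * φ 0 Fin.elim0 := by rw [pow_succ', mul_assoc]; gcongr

theorem setLIntegral_allRounds_le (hG : ∀ r, MeasurableSet {p : (Fin r → Z) × Z | p.2 ∈ G r p.1})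
    {φ : ∀ r, (Fin r → Z) → ENNReal} {β : ENNReal} (hβ : β ≠ ⊤)
    (hφ : ∀ r h, ∫⁻ ρ in G r h, φ (r + 1) (Fin.snoc (α := fun _ => Z) h ρ) ∂(L r h) ≤ β * φ r h)
    (r : ℕ) : ∫⁻ h in allRounds G r, φ r h ∂(adaptiveLaw L r) ≤ β ^ r * φ 0 Fin.elim0 := by
  rw [← lintegral_indicator (measurableSet_allRounds hG r)]
  refine (lintegral_adaptiveLaw_le (φ := fun r => (allRounds G r).indicator (φ r)) hβ
    (fun r h => ?_) r).trans_eq (by simp [allRounds])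
  by_cases hh : h ∈ allRounds G r
  · have hround : ∀ ρ, (allRounds G (r + 1)).indicator (φ (r + 1)) (Fin.snoc h ρ) =
        (G r h).indicator (fun ρ => φ (r + 1) (Fin.snoc h ρ)) ρ := fun ρ => by
      by_cases hρ : ρ ∈ G r h <;> simp [snoc_mem_allRounds, hh, hρ]
    have hGm : MeasurableSet (G r h) := measurable_prodMk_left (hG r)
    simpa only [hround, lintegral_indicator hGm, Set.indicator_of_mem hh] using hφ r h
  · simp [Set.indicator, snoc_mem_allRounds, hh]

theorem measurable_map_snoc [∀ r h, IsProbabilityMeasure (L r h)] (hL : Measurable (L r)) :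
    Measurable fun h => (L r h).map fun ρ => Fin.snoc (α := fun _ => Z) h ρ := by
  let κ : Kernel (Fin r → Z) Z := ⟨L r, hL⟩
  have : IsMarkovKernel κ := ⟨fun h => inferInstanceAs (IsProbabilityMeasure (L r h))⟩
  refine Measure.measurable_of_measurable_coe _ fun s hs => ?_
  convert Kernel.measurable_kernel_prodMk_left (κ := κ) (measurable_snoc r hs) using 2 with h
  exact Measure.map_apply (measurable_snoc_left h) hs

theorem adaptiveLaw_succ_apply [∀ r h, IsProbabilityMeasure (L r h)] (hL : Measurable (L r))
    {s : Set (Fin (r + 1) → Z)} (hs : MeasurableSet s) :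
    adaptiveLaw L (r + 1) s =
      ∫⁻ h, L r h {ρ | Fin.snoc (α := fun _ => Z) h ρ ∈ s} ∂(adaptiveLaw L r) := by
  rw [adaptiveLaw, Measure.bind_apply hs (measurable_map_snoc hL).aemeasurable]
  exact lintegral_congr fun h => Measure.map_apply (measurable_snoc_left h) hs

theorem isProbabilityMeasure_adaptiveLaw [∀ r h, IsProbabilityMeasure (L r h)]
    (hL : ∀ r, Measurable (L r)) (r : ℕ) : IsProbabilityMeasure (adaptiveLaw L r) := by
  induction r with
  | zero => exact Measure.dirac.isProbabilityMeasure
  | succ r ih => exact ⟨by simp [adaptiveLaw_succ_apply (hL r) MeasurableSet.univ]⟩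

theorem adaptiveLaw_compl_allRounds_le [∀ r h, IsProbabilityMeasure (L r h)]
    (hL : ∀ r, Measurable (L r)) (hG : ∀ r, MeasurableSet {p : (Fin r → Z) × Z | p.2 ∈ G r p.1})
    {η : ENNReal} (hη : ∀ r h, L r h (G r h)ᶜ ≤ η) (r : ℕ) :
    adaptiveLaw L r (allRounds G r)ᶜ ≤ r * η := by
  induction r with
  | zero => simp [allRounds]
  | succ r ih =>
    have hA := (measurableSet_allRounds hG r).compl
    have := isProbabilityMeasure_adaptiveLaw hL r
    have hround : ∀ h, L r h {ρ | Fin.snoc (α := fun _ => Z) h ρ ∈ (allRounds G (r + 1))ᶜ} ≤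
        (allRounds G r)ᶜ.indicator 1 h + η := by
      intro h
      simp only [Set.mem_compl_iff, snoc_mem_allRounds]
      by_cases hh : h ∈ allRounds G r
      · simpa [hh, Set.compl_def] using hη r h
      · simp [hh]
    calc adaptiveLaw L (r + 1) (allRounds G (r + 1))ᶜ
        ≤ ∫⁻ h, (allRounds G r)ᶜ.indicator 1 h + η ∂(adaptiveLaw L r) := by
          rw [adaptiveLaw_succ_apply (hL r) (measurableSet_allRounds hG (r + 1)).compl]
          exact lintegral_mono hround
      _ = adaptiveLaw L r (allRounds G r)ᶜ + η := by
          rw [lintegral_add_right _ measurable_const, lintegral_indicator_one hA,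
            lintegral_const, measure_univ, mul_one]
      _ ≤ (r + 1 : ℕ) * η := by rw [Nat.cast_succ, add_one_mul]; gcongr

end AdaptiveSampling

section Weights

variable {X : Type*} {k nS nT : ℕ} {O : ∀ n : ℕ, Sample X n → X → Bool} {a e : ℝ}

/-- The bound that an accurate round gives for the error on the mixture of the classifier trained
on the sample `S`; it is also the denominator of the increments. -/
noncomputable def slack (O : ∀ n : ℕ, Sample X n → X → Bool) (a e : ℝ) (S : Sample X nS) : ℝ :=
  (1 + 3 * a) * empErr S (O nS S) + 3 * e

/-- The factor by which the empirical errors of the players are multiplied to get the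
increments. -/
noncomputable def stepSize (O : ∀ n : ℕ, Sample X n → X → Bool) (a e : ℝ) (S : Sample X nS) : ℝ :=
  e * a / slack O a e S

theorem three_mul_le_slack (ha : 0 ≤ a) (S : Sample X nS) : 3 * e ≤ slack O a e S :=
  le_add_of_nonneg_left (mul_nonneg (by linarith) (empErr_nonneg _ _))

theorem slack_pos (ha : 0 ≤ a) (he : 0 < e) (S : Sample X nS) : 0 < slack O a e S := by
  linarith [three_mul_le_slack (O := O) (e := e) ha S]

theorem stepSize_nonneg (ha : 0 ≤ a) (he : 0 < e) (S : Sample X nS) : 0 ≤ stepSize O a e S :=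
  div_nonneg (mul_nonneg he.le ha) (slack_pos ha he S).le

theorem stepSize_le (ha : 0 ≤ a) (he : 0 < e) (S : Sample X nS) : stepSize O a e S ≤ a / 3 := by
  rw [stepSize, div_le_div_iff₀ (slack_pos ha he S) three_pos]
  nlinarith [three_mul_le_slack (O := O) (e := e) ha S]

theorem increment_eq (ρ : RoundData X k nS nT) (i : Fin k) :
    increment O a e ρ i = empErr (ρ.2 i) (O nS ρ.1) * stepSize O a e ρ.1 := by
  rw [increment, roundClassifier, stepSize, slack, mul_assoc, mul_div_assoc]

theorem increment_nonneg (ha : 0 ≤ a) (he : 0 < e) (ρ : RoundData X k nS nT) (i : Fin k) :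
    0 ≤ increment O a e ρ i := by
  rw [increment_eq]
  exact mul_nonneg (empErr_nonneg _ _) (stepSize_nonneg ha he _)

theorem increment_le (ha : 0 ≤ a) (he : 0 < e) (ρ : RoundData X k nS nT) (i : Fin k) :
    increment O a e ρ i ≤ a / 3 := by
  rw [increment_eq]
  exact (mul_le_of_le_one_left (stepSize_nonneg ha he _) (empErr_le_one _ _)).trans
    (stepSize_le ha he _)

theorem weight_snoc (r : ℕ) (h : Fin r → RoundData X k nS nT) (ρ : RoundData X k nS nT)
    (i : Fin k) :
    weight O a e (r + 1) (Fin.snoc (α := fun _ => RoundData X k nS nT) h ρ) i =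
      weight O a e r h i * (1 + increment O a e ρ i) := by
  simp [weight]

theorem weight_eq_prod (r : ℕ) (h : Fin r → RoundData X k nS nT) (i : Fin k) :
    weight O a e r h i = ∏ j, (1 + increment O a e (h j) i) := by
  induction r with
  | zero => simp [weight]
  | succ r ih =>
    rw [weight, ih, Fin.prod_univ_castSucc]
    rfl

theorem weight_pos (ha : 0 ≤ a) (he : 0 < e) (r : ℕ) (h : Fin r → RoundData X k nS nT)
    (i : Fin k) : 0 < weight O a e r h i := by
  rw [weight_eq_prod]
  exact Finset.prod_pos fun j _ => by linarith [increment_nonneg (O := O) ha he (h j) i]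

theorem sum_weight_pos (ha : 0 ≤ a) (he : 0 < e) (hk : 0 < k) (r : ℕ)
    (h : Fin r → RoundData X k nS nT) : 0 < ∑ i, weight O a e r h i :=
  Finset.sum_pos (fun i _ => weight_pos ha he r h i) ⟨⟨0, hk⟩, Finset.mem_univ _⟩

variable [MeasurableSpace X]

theorem measurable_slack (hO : Measurable fun p : Sample X nS × X => O nS p.1 p.2) :
    Measurable fun S : Sample X nS => slack O a e S :=
  ((measurable_empErr hO measurable_id).const_mul _).add_const _

theorem measurable_stepSize (hO : Measurable fun p : Sample X nS × X => O nS p.1 p.2) :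
    Measurable fun S : Sample X nS => stepSize O a e S :=
  (measurable_slack hO).const_div _

theorem measurable_increment (hO : Measurable fun p : Sample X nS × X => O nS p.1 p.2)
    (i : Fin k) : Measurable fun ρ : RoundData X k nS nT => increment O a e ρ i := by
  simp only [increment_eq]
  have hG : Measurable fun p : RoundData X k nS nT × X => O nS p.1.1 p.2 :=
    hO.comp ((measurable_fst.comp measurable_fst).prodMk measurable_snd)
  exact (measurable_empErr hG ((measurable_pi_apply i).comp measurable_snd)).mul
    ((measurable_stepSize hO).comp measurable_fst)

theorem measurable_weight (hO : Measurable fun p : Sample X nS × X => O nS p.1 p.2)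
    (r : ℕ) (i : Fin k) :
    Measurable fun h : Fin r → RoundData X k nS nT => weight O a e r h i := by
  simp only [weight_eq_prod]
  exact Finset.measurable_prod _ fun j _ =>
    ((measurable_increment hO i).comp (measurable_pi_apply j)).const_add 1

end Weights

section RoundLaw

variable {X : Type*} [MeasurableSpace X] {k nS nT : ℕ} {O : ∀ n : ℕ, Sample X n → X → Bool}
  {a e : ℝ} (D : Fin k → Measure (X × Bool)) {w : Fin k → ℝ}

theorem runLaw_eq_adaptiveLaw (r : ℕ) :
    (runLaw D O a e r : Measure (Fin r → RoundData X k nS nT)) =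
      adaptiveLaw (roundLaw D O a e) r := by
  induction r with
  | zero => rfl
  | succ r ih => rw [runLaw, adaptiveLaw, ih]

theorem measurable_mixture_weight (hO : Measurable fun p : Sample X nS × X => O nS p.1 p.2)
    (r : ℕ) :
    Measurable fun h : Fin r → RoundData X k nS nT => mixture D (weight O a e r h) := by
  refine Measure.measurable_of_measurable_coe _ fun s _ => ?_
  simp only [mixture, Measure.coe_finsetSum, Measure.coe_smul, Finset.sum_apply, Pi.smul_apply,
    smul_eq_mul]
  exact Finset.measurable_sum _ fun i _ => ((measurable_weight hO r i).div
    (Finset.measurable_sum _ fun j _ => measurable_weight hO r j)).ennreal_ofReal.mul_const _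

variable [∀ i, IsProbabilityMeasure (D i)]

theorem isProbabilityMeasure_mixture (hw : ∀ i, 0 ≤ w i) (hW : 0 < ∑ i, w i) :
    IsProbabilityMeasure (mixture D w) := by
  constructor
  simp only [mixture, Measure.coe_finsetSum, Measure.coe_smul, Finset.sum_apply, Pi.smul_apply,
    measure_univ, smul_eq_mul, mul_one]
  rw [← ENNReal.ofReal_sum_of_nonneg fun i _ => div_nonneg (hw i) hW.le, ← Finset.sum_div,
    div_self hW.ne', ENNReal.ofReal_one]

theorem err_mixture (hw : ∀ i, 0 ≤ w i) (f : X → Bool) :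
    err (mixture D w) f = (∑ i, w i * err (D i) f) / ∑ i, w i := by
  have hW : 0 ≤ ∑ i, w i := Finset.sum_nonneg fun i _ => hw i
  simp only [err, mixture, measureReal_def, Measure.coe_finsetSum, Measure.coe_smul,
    Finset.sum_apply, Pi.smul_apply, smul_eq_mul]
  rw [ENNReal.toReal_sum fun i _ => ENNReal.mul_ne_top ENNReal.ofReal_ne_top (measure_ne_top _ _),
    Finset.sum_div]
  refine Finset.sum_congr rfl fun i _ => ?_
  rw [ENNReal.toReal_mul, ENNReal.toReal_ofReal (div_nonneg (hw i) hW), mul_div_right_comm]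

theorem isProbabilityMeasure_mixture_weight (ha : 0 ≤ a) (he : 0 < e) (hk : 0 < k) (r : ℕ)
    (h : Fin r → RoundData X k nS nT) : IsProbabilityMeasure (mixture D (weight O a e r h)) :=
  isProbabilityMeasure_mixture D (fun i => (weight_pos ha he r h i).le)
    (sum_weight_pos ha he hk r h)

theorem isProbabilityMeasure_roundLaw (ha : 0 ≤ a) (he : 0 < e) (hk : 0 < k) (r : ℕ)
    (h : Fin r → RoundData X k nS nT) : IsProbabilityMeasure (roundLaw D O a e r h) := by
  have := isProbabilityMeasure_mixture_weight (O := O) D ha he hk r h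
  unfold roundLaw
  infer_instance

theorem measurable_roundLaw (hO : Measurable fun p : Sample X nS × X => O nS p.1 p.2)
    (ha : 0 ≤ a) (he : 0 < e) (hk : 0 < k) (r : ℕ) :
    Measurable fun h : Fin r → RoundData X k nS nT => roundLaw D O a e r h := by
  have := isProbabilityMeasure_mixture_weight (nS := nS) (nT := nT) (O := O) D ha he hk r
  have := isProbabilityMeasure_roundLaw (nS := nS) (nT := nT) (O := O) D ha he hk r
  have hpi : Measurable fun h : Fin r → RoundData X k nS nT =>
      Measure.pi fun _ : Fin nS => mixture D (weight O a e r h) := by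
    refine Measurable.measure_of_isPiSystem_of_isProbabilityMeasure generateFrom_pi.symm
      isPiSystem_pi ?_
    rintro _ ⟨s, hs, rfl⟩
    have hs' : ∀ j, MeasurableSet (s j) := fun j => hs j (Set.mem_univ j)
    simp only [Measure.pi_pi]
    exact Finset.measurable_prod _ fun j _ =>
      (Measure.measurable_coe (hs' j)).comp (measurable_mixture_weight D hO r)
  refine Measurable.measure_of_isPiSystem_of_isProbabilityMeasure generateFrom_prod.symm
    isPiSystem_prod ?_
  rintro _ ⟨u, (hu : MeasurableSet u), v, -, rfl⟩
  simp only [roundLaw, Measure.prod_prod]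
  exact ((Measure.measurable_coe hu).comp hpi).mul_const _

end RoundLaw

section Potentials

variable {X : Type*} [MeasurableSpace X] {k nS nT : ℕ} {O : ∀ n : ℕ, Sample X n → X → Bool}
  {a e θ : ℝ} {D : Fin k → Measure (X × Bool)} {w : Fin k → ℝ} {f : X → Bool}

/-- The joint law of the samples of size `nT` that the players draw in one round. -/
noncomputable abbrev playersLaw (D : Fin k → Measure (X × Bool)) (nT : ℕ) :
    Measure (Fin k → Sample X nT) :=
  Measure.pi fun i => Measure.pi fun _ : Fin nT => D i

/-- The samples `S` from the mixture with weights `w` after which the round is accurate: the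
classifier trained on `S` has error at most the slack on the mixture and at most `θ` on `S`. -/
def accurateSamples (D : Fin k → Measure (X × Bool)) (O : ∀ n : ℕ, Sample X n → X → Bool)
    (a e θ : ℝ) (w : Fin k → ℝ) : Set (Sample X nS) :=
  {S | err (mixture D w) (O nS S) ≤ slack O a e S ∧ empErr S (O nS S) ≤ θ}

/-- The accurate outcomes of the round that follows the history `h`. -/
def accurateRounds (D : Fin k → Measure (X × Bool)) (O : ∀ n : ℕ, Sample X n → X → Bool)
    (a e θ : ℝ) (r : ℕ) (h : Fin r → RoundData X k nS nT) : Set (RoundData X k nS nT) :=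
  Prod.fst ⁻¹' accurateSamples D O a e θ (weight O a e r h)

/-- The conditional expectation of the increment of player `i`, given the sample `S` from the
mixture. -/
noncomputable def meanIncrement (D : Fin k → Measure (X × Bool))
    (O : ∀ n : ℕ, Sample X n → X → Bool) (a e : ℝ) (S : Sample X nS) (i : Fin k) : ℝ :=
  err (D i) (O nS S) * stepSize O a e S

/-- The factor by which the weight of player `i` after the history `h` falls short of the
exponential of (nearly) the sum of its mean increments. -/
noncomputable def weightDeficit (D : Fin k → Measure (X × Bool))
    (O : ∀ n : ℕ, Sample X n → X → Bool) (a e : ℝ) (i : Fin k) (r : ℕ)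
    (h : Fin r → RoundData X k nS nT) : ℝ :=
  Real.exp ((1 - a / 3) * ∑ j, meanIncrement D O a e (h j).1 i) / weight O a e r h i

theorem weightDeficit_snoc (i : Fin k) (r : ℕ) (h : Fin r → RoundData X k nS nT)
    (ρ : RoundData X k nS nT) :
    weightDeficit D O a e i (r + 1) (Fin.snoc (α := fun _ => RoundData X k nS nT) h ρ) =
      weightDeficit D O a e i r h *
        (Real.exp ((1 - a / 3) * meanIncrement D O a e ρ.1 i) / (1 + increment O a e ρ i)) := by
  simp only [weightDeficit, weight_snoc, Fin.sum_univ_castSucc, Fin.snoc_castSucc, Fin.snoc_last,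
    mul_add, Real.exp_add, div_mul_div_comm]

theorem setLIntegral_fst_preimage_le {Y Y' : Type*} [MeasurableSpace Y] [MeasurableSpace Y']
    {μ : Measure Y} {ν : Measure Y'} [IsProbabilityMeasure μ] [SFinite ν] {B : Set Y}
    (hB : MeasurableSet B) {φ : Y × Y' → ENNReal} {C : ENNReal}
    (hφ : ∀ y ∈ B, ∫⁻ y', φ (y, y') ∂ν ≤ C) :
    ∫⁻ p in Prod.fst ⁻¹' B, φ p ∂(μ.prod ν) ≤ C := by
  calc ∫⁻ p in Prod.fst ⁻¹' B, φ p ∂(μ.prod ν)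
      = ∫⁻ p, φ p ∂((μ.restrict B).prod ν) := by
        rw [← Set.prod_univ, ← Measure.prod_restrict, Measure.restrict_univ]
    _ ≤ ∫⁻ y in B, ∫⁻ y', φ (y, y') ∂ν ∂μ := lintegral_prod_le _
    _ ≤ ∫⁻ _ in B, C ∂μ := setLIntegral_mono' hB hφ
    _ ≤ C := by
        rw [setLIntegral_const]
        exact mul_le_of_le_one_right' prob_le_one

section Players

variable [∀ i, IsProbabilityMeasure (D i)]

theorem integrable_empErr_player (hf : Measurable f) (i : Fin k) :
    Integrable (fun T : Fin k → Sample X nT => empErr (T i) f) (playersLaw D nT) := by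
  have hG : Measurable fun p : (Fin k → Sample X nT) × X => f p.2 := hf.comp measurable_snd
  exact .of_mem_Icc 0 1 (measurable_empErr hG (measurable_pi_apply i)).aemeasurable
    (Filter.Eventually.of_forall fun T => ⟨empErr_nonneg _ _, empErr_le_one _ _⟩)

theorem integral_empErr_player (hT : 0 < nT) (hf : Measurable f) (i : Fin k) :
    ∫ T : Fin k → Sample X nT, empErr (T i) f ∂(playersLaw D nT) = err (D i) f := by
  have hG : Measurable fun p : Sample X nT × X => f p.2 := hf.comp measurable_snd
  rw [integral_comp_eval (μ := fun i : Fin k => Measure.pi fun _ : Fin nT => D i) (i := i)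
    (f := fun S : Sample X nT => empErr S f)
    (measurable_empErr hG measurable_id).aestronglyMeasurable, integral_empErr hT _ hf]

theorem lintegral_ofReal_add_sum_empErr (hT : 0 < nT) (hf : Measurable f) (s : Finset (Fin k))
    {A : ℝ} {B : Fin k → ℝ}
    (h0 : ∀ T : Fin k → Sample X nT, 0 ≤ A + ∑ i ∈ s, B i * empErr (T i) f) :
    ∫⁻ T : Fin k → Sample X nT, ENNReal.ofReal (A + ∑ i ∈ s, B i * empErr (T i) f)
      ∂(playersLaw D nT) = ENNReal.ofReal (A + ∑ i ∈ s, B i * err (D i) f) := by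
  have hterm : ∀ i ∈ s, Integrable (fun T : Fin k → Sample X nT => B i * empErr (T i) f)
      (playersLaw D nT) := fun i _ => (integrable_empErr_player hf i).const_mul _
  have hsum := integrable_finsetSum s hterm
  have hint : Integrable (fun T : Fin k → Sample X nT => A + ∑ i ∈ s, B i * empErr (T i) f)
      (playersLaw D nT) := (integrable_const A).add hsum
  rw [← ofReal_integral_eq_lintegral_ofReal hint (Filter.Eventually.of_forall h0),
    integral_add (integrable_const A) hsum, integral_finsetSum s hterm]
  simp only [integral_const_mul, integral_empErr_player hT hf, integral_const, probReal_univ,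
    one_smul]

theorem lintegral_sum_weight_round_le (hO : Measurable fun p : Sample X nS × X => O nS p.1 p.2)
    (ha : 0 ≤ a) (he : 0 < e) (hT : 0 < nT) (hw : ∀ i, 0 ≤ w i) (hW : 0 < ∑ i, w i)
    {S : Sample X nS} (hS : S ∈ accurateSamples D O a e θ w) :
    ∫⁻ T : Fin k → Sample X nT, ENNReal.ofReal (∑ i, w i * (1 + increment O a e (S, T) i))
      ∂(playersLaw D nT) ≤ ENNReal.ofReal (1 + e * a) * ENNReal.ofReal (∑ i, w i) := by
  have haffine : ∀ T : Fin k → Sample X nT, ∑ i, w i * (1 + increment O a e (S, T) i) =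
      ∑ i, w i + ∑ i, w i * stepSize O a e S * empErr (T i) (O nS S) := fun T => by
    rw [← Finset.sum_add_distrib]
    exact Finset.sum_congr rfl fun i _ => by rw [increment_eq]; ring
  have hmix : ∑ i, w i * err (D i) (O nS S) ≤ slack O a e S * ∑ i, w i := by
    rw [← div_le_iff₀ hW, ← err_mixture D hw]
    exact hS.1
  simp only [haffine]
  rw [lintegral_ofReal_add_sum_empErr hT hO.of_uncurry_left Finset.univ fun T => by
    rw [← haffine]
    exact Finset.sum_nonneg fun i _ =>
      mul_nonneg (hw i) (by linarith [increment_nonneg (O := O) ha he (S, T) i]),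
    ← ENNReal.ofReal_mul (by positivity)]
  refine ENNReal.ofReal_le_ofReal ?_
  calc ∑ i, w i + ∑ i, w i * stepSize O a e S * err (D i) (O nS S)
      = ∑ i, w i + stepSize O a e S * ∑ i, w i * err (D i) (O nS S) := by
        rw [Finset.mul_sum]
        congr! 2 with i
        ring
    _ ≤ ∑ i, w i + stepSize O a e S * (slack O a e S * ∑ i, w i) := by
        gcongr
        exact stepSize_nonneg ha he S
    _ = (1 + e * a) * ∑ i, w i := by
        rw [← mul_assoc, stepSize, div_mul_cancel₀ _ (slack_pos ha he S).ne', one_add_mul]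

theorem inv_one_add_le {s : ℝ} (hs : 0 ≤ s) (hsa : s ≤ a / 3) :
    (1 + s)⁻¹ ≤ 1 - (1 - a / 3) * s := by
  rw [inv_le_iff_one_le_mul₀' (by linarith)]
  nlinarith [mul_nonneg hs (sub_nonneg.2 hsa), mul_nonneg hs hs]

theorem lintegral_inv_one_add_increment_le
    (hO : Measurable fun p : Sample X nS × X => O nS p.1 p.2) (ha : 0 ≤ a)
    (he : 0 < e) (hT : 0 < nT) (S : Sample X nS) (i : Fin k) :
    ∫⁻ T : Fin k → Sample X nT, ENNReal.ofReal (Real.exp ((1 - a / 3) * meanIncrement D O a e S i) /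
      (1 + increment O a e (S, T) i)) ∂(playersLaw D nT) ≤ 1 := by
  set E := Real.exp ((1 - a / 3) * meanIncrement D O a e S i) with hE
  set B := fun _ : Fin k => -((1 - a / 3) * stepSize O a e S * E) with hB
  have hE0 : 0 < E := Real.exp_pos _
  have hlinear : ∀ T : Fin k → Sample X nT, E / (1 + increment O a e (S, T) i) ≤
      E + ∑ j ∈ {i}, B j * empErr (T j) (O nS S) := fun T => by
    calc E / (1 + increment O a e (S, T) i)
        ≤ E * (1 - (1 - a / 3) * increment O a e (S, T) i) :=
          mul_le_mul_of_nonneg_left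
            (inv_one_add_le (increment_nonneg ha he _ i) (increment_le ha he _ i)) hE0.le
      _ = E + ∑ j ∈ {i}, B j * empErr (T j) (O nS S) := by
          rw [Finset.sum_singleton, increment_eq]
          ring
  have hpos : ∀ T : Fin k → Sample X nT, 0 ≤ E / (1 + increment O a e (S, T) i) := fun T =>
    div_nonneg hE0.le (by linarith [increment_nonneg (O := O) ha he (S, T) i])
  refine (lintegral_mono fun T => ENNReal.ofReal_le_ofReal (hlinear T)).trans ?_
  rw [lintegral_ofReal_add_sum_empErr hT hO.of_uncurry_left {i} fun T =>
    (hpos T).trans (hlinear T), Finset.sum_singleton]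
  refine ENNReal.ofReal_le_one.2 ?_
  calc E + B i * err (D i) (O nS S)
      = (1 - (1 - a / 3) * meanIncrement D O a e S i) * E := by
        rw [hB, meanIncrement]
        ring
    _ ≤ Real.exp (-((1 - a / 3) * meanIncrement D O a e S i)) * E := by
        gcongr
        exact Real.one_sub_le_exp_neg _
    _ = 1 := by rw [hE, ← Real.exp_add, neg_add_cancel, Real.exp_zero]

end Players

end Potentials

section Runs

variable {X : Type*} [MeasurableSpace X] {k nS nT : ℕ} {O : ∀ n : ℕ, Sample X n → X → Bool}
  {a e θ : ℝ} {D : Fin k → Measure (X × Bool)} [∀ i, IsProbabilityMeasure (D i)]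

theorem isProbabilityMeasure_runLaw (hO : Measurable fun p : Sample X nS × X => O nS p.1 p.2)
    (ha : 0 ≤ a) (he : 0 < e) (hk : 0 < k) (r : ℕ) :
    IsProbabilityMeasure (runLaw D O a e r : Measure (Fin r → RoundData X k nS nT)) := by
  have := isProbabilityMeasure_roundLaw (nS := nS) (nT := nT) (O := O) D ha he hk
  rw [runLaw_eq_adaptiveLaw]
  exact isProbabilityMeasure_adaptiveLaw (measurable_roundLaw D hO ha he hk) r

theorem measurableSet_mem_accurateSamples
    (hO : Measurable fun p : Sample X nS × X => O nS p.1 p.2) {Y : Type*} [MeasurableSpace Y]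
    {w : Y → Fin k → ℝ} (hw : ∀ i, Measurable fun y => w y i) (hw0 : ∀ y i, 0 ≤ w y i)
    {S : Y → Sample X nS} (hS : Measurable S) :
    MeasurableSet {y | S y ∈ accurateSamples D O a e θ (w y)} := by
  refine (measurableSet_le ?_ ((measurable_slack hO).comp hS)).inter
    (measurableSet_le ((measurable_empErr hO measurable_id).comp hS) measurable_const)
  simp only [fun y => err_mixture D (hw0 y)]
  exact (Finset.measurable_sum _ fun i _ => (hw i).mul ((measurable_err hO (D i)).comp hS)).div
    (Finset.measurable_sum _ fun i _ => hw i)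

theorem measurableSet_accurateRounds
    (hO : Measurable fun p : Sample X nS × X => O nS p.1 p.2) (ha : 0 ≤ a) (he : 0 < e) (r : ℕ) :
    MeasurableSet {p : (Fin r → RoundData X k nS nT) × RoundData X k nS nT |
      p.2 ∈ accurateRounds D O a e θ r p.1} :=
  measurableSet_mem_accurateSamples hO (Y := (Fin r → RoundData X k nS nT) × RoundData X k nS nT)
    (w := fun p => weight O a e r p.1) (S := fun p => p.2.1)
    (fun i => (measurable_weight hO r i).comp measurable_fst)
    (fun p i => (weight_pos ha he r p.1 i).le) (measurable_fst.comp measurable_snd)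

theorem runLaw_compl_allRounds_accurateRounds_le
    (hO : Measurable fun p : Sample X nS × X => O nS p.1 p.2) (ha : 0 ≤ a) (he : 0 < e)
    (hk : 0 < k) {η : ENNReal}
    (hη : ∀ r (h : Fin r → RoundData X k nS nT),
      (Measure.pi fun _ : Fin nS => mixture D (weight O a e r h))
        (accurateSamples D O a e θ (weight O a e r h))ᶜ ≤ η) (r : ℕ) :
    runLaw D O a e r
      (allRounds (accurateRounds D O a e θ) r : Set (Fin r → RoundData X k nS nT))ᶜ ≤ r * η := by
  have := isProbabilityMeasure_roundLaw (nS := nS) (nT := nT) (O := O) D ha he hk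
  rw [runLaw_eq_adaptiveLaw]
  refine adaptiveLaw_compl_allRounds_le (measurable_roundLaw D hO ha he hk)
    (measurableSet_accurateRounds hO ha he) (fun r h => ?_) r
  have := isProbabilityMeasure_mixture_weight (O := O) D ha he hk r h
  rw [accurateRounds, ← Set.preimage_compl, ← Set.prod_univ, roundLaw, Measure.prod_prod,
    measure_univ, mul_one]
  exact hη r h

theorem setLIntegral_sum_weight_le (hO : Measurable fun p : Sample X nS × X => O nS p.1 p.2)
    (ha : 0 ≤ a) (he : 0 < e) (hk : 0 < k) (hT : 0 < nT) (r : ℕ) :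
    ∫⁻ h : Fin r → RoundData X k nS nT in allRounds (accurateRounds D O a e θ) r,
      ENNReal.ofReal (∑ i, weight O a e r h i) ∂(runLaw D O a e r) ≤
      ENNReal.ofReal (1 + e * a) ^ r * k := by
  rw [runLaw_eq_adaptiveLaw]
  refine (setLIntegral_allRounds_le (measurableSet_accurateRounds hO ha he)
    (φ := fun r h => ENNReal.ofReal (∑ i, weight O a e r h i))
    (β := ENNReal.ofReal (1 + e * a)) ENNReal.ofReal_ne_top (fun r h => ?_)
    r).trans_eq (by simp [weight])
  have := isProbabilityMeasure_mixture_weight (O := O) D ha he hk r h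
  have hw : ∀ i, 0 ≤ weight O a e r h i := fun i => (weight_pos ha he r h i).le
  simp only [weight_snoc]
  have hmeas : MeasurableSet (accurateSamples (nS := nS) D O a e θ (weight O a e r h)) :=
    measurableSet_mem_accurateSamples hO (w := fun _ => weight O a e r h) (S := fun S => S)
      (fun _ => measurable_const) (fun _ => hw) measurable_id
  exact setLIntegral_fst_preimage_le hmeas fun S hS =>
    lintegral_sum_weight_round_le hO ha he hT hw (sum_weight_pos ha he hk r h) hS

theorem measurable_weightDeficit (hO : Measurable fun p : Sample X nS × X => O nS p.1 p.2)
    (i : Fin k) (r : ℕ) :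
    Measurable fun h : Fin r → RoundData X k nS nT => weightDeficit D O a e i r h := by
  have hmean : Measurable fun S : Sample X nS => meanIncrement D O a e S i :=
    (measurable_err hO (D i)).mul (measurable_stepSize hO)
  exact (Real.measurable_exp.comp ((Finset.measurable_sum _ fun j _ =>
    hmean.comp (measurable_fst.comp (measurable_pi_apply j))).const_mul _)).div
    (measurable_weight hO r i)

theorem lintegral_weightDeficit_le (hO : Measurable fun p : Sample X nS × X => O nS p.1 p.2)
    (ha : 0 ≤ a) (he : 0 < e) (hk : 0 < k) (hT : 0 < nT) (i : Fin k) (r : ℕ) :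
    ∫⁻ h : Fin r → RoundData X k nS nT, ENNReal.ofReal (weightDeficit D O a e i r h)
      ∂(runLaw D O a e r) ≤ 1 := by
  rw [runLaw_eq_adaptiveLaw]
  refine (lintegral_adaptiveLaw_le (φ := fun r h => ENNReal.ofReal (weightDeficit D O a e i r h))
    ENNReal.one_ne_top (fun r h => ?_) r).trans_eq (by simp [weightDeficit, weight])
  have := isProbabilityMeasure_mixture_weight (O := O) D ha he hk r h
  have hdeficit : 0 ≤ weightDeficit D O a e i r h :=
    div_nonneg (Real.exp_pos _).le (weight_pos ha he r h i).le
  simp only [weightDeficit_snoc, ENNReal.ofReal_mul hdeficit]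
  rw [lintegral_const_mul' _ _ ENNReal.ofReal_ne_top, one_mul, ← setLIntegral_univ,
    ← Set.preimage_univ (f := Prod.fst)]
  exact mul_le_of_le_one_right' (setLIntegral_fst_preimage_le MeasurableSet.univ fun S _ =>
    lintegral_inv_one_add_increment_le hO ha he hT S i)

end Runs

section AverageError

variable {X : Type*} [MeasurableSpace X] {k nS nT t : ℕ} {O : ∀ n : ℕ, Sample X n → X → Bool}
  {a e θ M : ℝ} {D : Fin k → Measure (X × Bool)} {h : Fin t → RoundData X k nS nT}

theorem sum_meanIncrement_le (ha : 0 ≤ a) (he : 0 < e) (hM : 0 < M)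
    (hW : ∑ i, weight O a e t h i ≤ M * (1 + e * a) ^ t) {i : Fin k}
    (hi : weightDeficit D O a e i t h ≤ M) :
    (1 - a / 3) * ∑ j, meanIncrement D O a e (h j).1 i ≤ 2 * Real.log M + t * (e * a) := by
  have hw : weight O a e t h i ≤ M * Real.exp (e * a) ^ t :=
    calc weight O a e t h i ≤ ∑ i, weight O a e t h i :=
          Finset.single_le_sum (fun i _ => (weight_pos ha he t h i).le) (Finset.mem_univ i)
      _ ≤ M * (1 + e * a) ^ t := hW
      _ ≤ M * Real.exp (e * a) ^ t := by
          gcongr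
          rw [add_comm]
          exact Real.add_one_le_exp _
  rw [weightDeficit, div_le_iff₀ (weight_pos ha he t h i)] at hi
  refine Real.exp_le_exp.1 ((hi.trans (mul_le_mul_of_nonneg_left hw hM.le)).trans_eq ?_)
  rw [two_mul, Real.exp_add, Real.exp_add, Real.exp_log hM, Real.exp_nat_mul, mul_assoc]

theorem sum_err_mul_le_sum_meanIncrement (ha : 0 ≤ a) (he : 0 < e) {Γ : ℝ}
    (hΓ : ∀ j, slack O a e (h j).1 ≤ Γ) (i : Fin k) :
    (∑ j, err (D i) (O nS (h j).1)) * (e * a / Γ) ≤ ∑ j, meanIncrement D O a e (h j).1 i := by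
  rw [Finset.sum_mul]
  exact Finset.sum_le_sum fun j _ => mul_le_mul_of_nonneg_left
    (div_le_div_of_nonneg_left (by positivity) (slack_pos ha he _) (hΓ j)) (err_nonneg _ _)

theorem slack_le_of_mem_allRounds (ha : 0 ≤ a)
    (hacc : h ∈ allRounds (accurateRounds D O a e θ) t) (j : Fin t) :
    slack O a e (h j).1 ≤ (1 + 3 * a) * θ + 3 * e := by
  have hround : ∀ r (h : Fin r → RoundData X k nS nT), ∀ ρ ∈ accurateRounds D O a e θ r h,
      slack O a e ρ.1 ≤ (1 + 3 * a) * θ + 3 * e := fun r h ρ hρ => by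
    unfold slack
    gcongr
    exact hρ.2
  exact apply_of_mem_allRounds (p := fun ρ : RoundData X k nS nT =>
    slack O a e ρ.1 ≤ (1 + 3 * a) * θ + 3 * e) hround hacc j

theorem average_err_le (ht : 0 < t) (ha : 0 < a) (ha3 : a < 3) (he : 0 < e) (hM : 0 < M)
    (hlog : Real.log M ≤ e * a ^ 2 * t / 2)
    (hacc : h ∈ allRounds (accurateRounds D O a e θ) t)
    (hW : ∑ i, weight O a e t h i ≤ M * (1 + e * a) ^ t) {i : Fin k}
    (hi : weightDeficit D O a e i t h ≤ M) :
    (∑ j, err (D i) (O nS (h j).1)) / t ≤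
      (1 + a) / (1 - a / 3) * ((1 + 3 * a) * θ + 3 * e) := by
  have hb0 : 0 < 1 - a / 3 := by linarith
  have hsum := sum_meanIncrement_le ha.le he hM hW hi
  have hslack := slack_le_of_mem_allRounds ha.le hacc
  set b := 1 - a / 3
  set Γ := (1 + 3 * a) * θ + 3 * e
  set E := ∑ j, err (D i) (O nS (h j).1)
  have hΓ : 0 < Γ := (slack_pos ha.le he _).trans_le (hslack ⟨0, ht⟩)
  have hE : b * (E * (e * a / Γ)) ≤ e * a * (t * (1 + a)) :=
    calc b * (E * (e * a / Γ))
        ≤ b * ∑ j, meanIncrement D O a e (h j).1 i := by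
          gcongr
          exact sum_err_mul_le_sum_meanIncrement ha.le he hslack i
      _ ≤ 2 * Real.log M + t * (e * a) := hsum
      _ ≤ e * a * (t * (1 + a)) := by linarith
  calc E / t = b * (E * (e * a / Γ)) * (Γ / (e * a * t * b)) := by
        field_simp
    _ ≤ e * a * (t * (1 + a)) * (Γ / (e * a * t * b)) := by gcongr
    _ = (1 + a) / b * Γ := by field_simp

end AverageError

section SuccessProbability

variable {X : Type*} [MeasurableSpace X] {k nS nT t : ℕ} {O : ∀ n : ℕ, Sample X n → X → Bool}
  {a e θ M : ℝ} {D : Fin k → Measure (X × Bool)} [∀ i, IsProbabilityMeasure (D i)]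

theorem measure_inter_setOf_lt_le {Ω : Type*} [MeasurableSpace Ω] {μ : Measure Ω} {B : Set Ω}
    {φ : Ω → ℝ} (hφ : Measurable φ) {b c : ℝ} (hc : 0 < c)
    (h : ∫⁻ ω in B, ENNReal.ofReal (φ ω) ∂μ ≤ ENNReal.ofReal b) :
    μ (B ∩ {ω | c < φ ω}) ≤ ENNReal.ofReal (b / c) := by
  rw [ENNReal.ofReal_div_of_pos hc, Set.inter_comm]
  calc μ ({ω | c < φ ω} ∩ B)
      ≤ μ.restrict B {ω | c < φ ω} := Measure.le_restrict_apply _ _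
    _ ≤ μ.restrict B {ω | ENNReal.ofReal c ≤ ENNReal.ofReal (φ ω)} :=
        measure_mono fun ω (hω : c < φ ω) => ENNReal.ofReal_le_ofReal hω.le
    _ ≤ (∫⁻ ω in B, ENNReal.ofReal (φ ω) ∂μ) / ENNReal.ofReal c :=
        meas_ge_le_lintegral_div hφ.ennreal_ofReal.aemeasurable (ENNReal.ofReal_pos.2 hc).ne'
          ENNReal.ofReal_ne_top
    _ ≤ ENNReal.ofReal b / ENNReal.ofReal c := by gcongr

theorem runLaw_lt_sum_weight_le (hO : Measurable fun p : Sample X nS × X => O nS p.1 p.2)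
    (ha : 0 ≤ a) (he : 0 < e) (hk : 0 < k) (hT : 0 < nT) (hM : 0 < M) :
    runLaw D O a e t ((allRounds (accurateRounds D O a e θ) t :
      Set (Fin t → RoundData X k nS nT)) ∩ {h | M * (1 + e * a) ^ t < ∑ i, weight O a e t h i}) ≤
      ENNReal.ofReal (k / M) := by
  have hbound := setLIntegral_sum_weight_le (D := D) (θ := θ) hO ha he hk hT t
  rw [← ENNReal.ofReal_pow (by positivity), ← ENNReal.ofReal_natCast,
    ← ENNReal.ofReal_mul (by positivity)] at hbound
  refine (measure_inter_setOf_lt_le (Finset.measurable_sum _ fun i _ => measurable_weight hO t i)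
    (by positivity) hbound).trans_eq ?_
  rw [mul_comm M, mul_div_mul_left _ _ (by positivity)]

theorem runLaw_lt_weightDeficit_le (hO : Measurable fun p : Sample X nS × X => O nS p.1 p.2)
    (ha : 0 ≤ a) (he : 0 < e) (hk : 0 < k) (hT : 0 < nT) (hM : 0 < M) :
    runLaw D O a e t (⋃ i, {h : Fin t → RoundData X k nS nT | M < weightDeficit D O a e i t h}) ≤
      ENNReal.ofReal (k / M) := by
  have hplayer : ∀ i, runLaw D O a e t {h : Fin t → RoundData X k nS nT |
      M < weightDeficit D O a e i t h} ≤ ENNReal.ofReal (1 / M) := fun i => by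
    rw [← Set.univ_inter {h | M < _}]
    refine measure_inter_setOf_lt_le (measurable_weightDeficit hO i t) hM ?_
    rw [setLIntegral_univ, ENNReal.ofReal_one]
    exact lintegral_weightDeficit_le hO ha he hk hT i t
  refine (measure_iUnion_fintype_le _ _).trans
    ((Finset.sum_le_sum fun i _ => hplayer i).trans_eq ?_)
  rw [Finset.sum_const, Finset.card_univ, Fintype.card_fin, nsmul_eq_mul,
    ← ENNReal.ofReal_natCast k, ← ENNReal.ofReal_mul (by positivity), mul_one_div]

theorem runLaw_average_err_le (hO : Measurable fun p : Sample X nS × X => O nS p.1 p.2)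
    (ha : 0 < a) (ha3 : a < 3) (he : 0 < e) (hk : 0 < k) (hT : 0 < nT) {η : ℝ} (hη0 : 0 ≤ η)
    (hη : ∀ r (h : Fin r → RoundData X k nS nT),
      (Measure.pi fun _ : Fin nS => mixture D (weight O a e r h)).real
        (accurateSamples D O a e θ (weight O a e r h))ᶜ ≤ η)
    (ht : 0 < t) (hM : 0 < M) (hlog : Real.log M ≤ e * a ^ 2 * t / 2) :
    ENNReal.ofReal (1 - (t * η + 2 * (k / M))) ≤
      runLaw D O a e t {h : Fin t → RoundData X k nS nT | ∀ i,
        (∑ j, err (D i) (O nS (h j).1)) / t ≤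
          (1 + a) / (1 - a / 3) * ((1 + 3 * a) * θ + 3 * e)} := by
  have := isProbabilityMeasure_runLaw (nS := nS) (nT := nT) (D := D) hO ha.le he hk t
  set μ : Measure (Fin t → RoundData X k nS nT) := runLaw D O a e t
  set target : Set (Fin t → RoundData X k nS nT) := {h | ∀ i,
    (∑ j, err (D i) (O nS (h j).1)) / t ≤ (1 + a) / (1 - a / 3) * ((1 + 3 * a) * θ + 3 * e)}
  set A : Set (Fin t → RoundData X k nS nT) := allRounds (accurateRounds D O a e θ) t
  set W : Set (Fin t → RoundData X k nS nT) :=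
    {h | M * (1 + e * a) ^ t < ∑ i, weight O a e t h i}
  set U : Set (Fin t → RoundData X k nS nT) := ⋃ i, {h | M < weightDeficit D O a e i t h}
  have hA : μ Aᶜ ≤ ENNReal.ofReal (t * η) := by
    rw [ENNReal.ofReal_mul t.cast_nonneg, ENNReal.ofReal_natCast]
    refine runLaw_compl_allRounds_accurateRounds_le hO ha.le he hk (fun r h => ?_) t
    have := isProbabilityMeasure_mixture_weight (O := O) D ha.le he hk r h
    rw [← ofReal_measureReal]
    exact ENNReal.ofReal_le_ofReal (hη r h)
  have hcover : targetᶜ ⊆ Aᶜ ∪ (A ∩ W ∪ U) := fun h hh => by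
    by_contra hgood
    simp only [Set.mem_union, Set.mem_inter_iff, Set.mem_compl_iff, not_or, not_not,
      not_and] at hgood
    obtain ⟨hacc, hW, hU⟩ := hgood
    exact hh fun i => average_err_le ht ha ha3 he hM hlog hacc (not_lt.1 (hW hacc))
      (not_lt.1 fun hi => hU (Set.mem_iUnion.2 ⟨i, hi⟩))
  have htarget : μ targetᶜ ≤ ENNReal.ofReal (t * η + 2 * (k / M)) :=
    calc μ targetᶜ ≤ μ Aᶜ + (μ (A ∩ W) + μ U) :=
          (measure_mono hcover).trans ((measure_union_le _ _).trans
            (add_le_add_right (measure_union_le _ _) _))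
      _ ≤ ENNReal.ofReal (t * η) + (ENNReal.ofReal (k / M) + ENNReal.ofReal (k / M)) :=
          add_le_add hA (add_le_add (runLaw_lt_sum_weight_le hO ha.le he hk hT hM)
            (runLaw_lt_weightDeficit_le hO ha.le he hk hT hM))
      _ = ENNReal.ofReal (t * η + 2 * (k / M)) := by
          rw [two_mul, ENNReal.ofReal_add (by positivity) (by positivity),
            ENNReal.ofReal_add (by positivity) (by positivity)]
  rw [ENNReal.ofReal_sub _ (by positivity), ENNReal.ofReal_one, tsub_le_iff_right,
    ← measure_univ (μ := μ)]
  exact (measure_univ_le_add_compl target).trans (add_le_add_right htarget _)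

end SuccessProbability

section Output

variable {X : Type*}

theorem mixClassifier_apply {t : ℕ} (f : Fin t → X → Bool) (x : X) (y : Bool) :
    mixClassifier f x {b | b ≠ y} =
      (∑ r, Set.indicator {z : X × Bool | f r z.1 ≠ z.2} 1 (x, y)) * (t : ENNReal)⁻¹ := by
  rw [mixClassifier, Measure.map_apply (measurable_of_finite _) (Set.toFinite _).measurableSet,
    uniformOn_univ, Fintype.card_fin, div_eq_mul_inv,
    ← lintegral_indicator_one (MeasurableSet.of_discrete), lintegral_count, tsum_fintype]
  rfl

theorem expectedErr_mixClassifier [MeasurableSpace X] (P : Measure (X × Bool))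
    [IsFiniteMeasure P] {t : ℕ} {f : Fin t → X → Bool} (hf : ∀ r, Measurable (f r)) :
    expectedErr P (mixClassifier f) = (∑ r, err P (f r)) / t := by
  have hset : ∀ r, MeasurableSet {z : X × Bool | f r z.1 ≠ z.2} := fun r =>
    (measurableSet_eq_fun ((hf r).comp measurable_fst) measurable_snd).compl
  have hind : ∀ r ∈ Finset.univ, Measurable
      (Set.indicator {z : X × Bool | f r z.1 ≠ z.2} (1 : X × Bool → ENNReal)) := fun r _ =>
    measurable_one.indicator (hset r)
  simp only [expectedErr, mixClassifier_apply]
  rw [lintegral_mul_const _ (Finset.measurable_sum _ hind), lintegral_finsetSum _ hind,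
    ENNReal.toReal_mul, ENNReal.toReal_inv, ENNReal.toReal_natCast, ← div_eq_mul_inv]
  simp only [lintegral_indicator_one (hset _), err, measureReal_def,
    ENNReal.toReal_sum fun _ _ => measure_ne_top P _]

end Output

section AccurateRound

variable {X : Type*} [MeasurableSpace X] {k nS d : ℕ} {O : ∀ n : ℕ, Sample X n → X → Bool}
  {a e q : ℝ} {D : Fin k → Measure (X × Bool)} [∀ i, IsProbabilityMeasure (D i)]
  {F : Set (X → Bool)} {f : X → Bool} {w : Fin k → ℝ}

theorem measureReal_empErr_gt_le (P : Measure (X × Bool)) [IsProbabilityMeasure P]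
    (hf : Measurable f) (ha : 0 < a) (ha1 : a ≤ 1) :
    (Measure.pi fun _ : Fin nS => P).real {S | (1 + a) * err P f + e < empErr S f} ≤
      Real.exp (-(a * e * nS)) := by
  have hchernoff := measureReal_pi_sum_ge_le (ι := Fin nS) (P := P) (measurable_mislabel hf)
    (mislabel_mem_Icc f) (by rwa [abs_of_pos ha]) (a * e)
  rw [integral_mislabel P hf, Fintype.card_fin] at hchernoff
  refine (measureReal_mono fun S (hS : (1 + a) * err P f + e < empErr S f) => ?_).trans hchernoff
  calc nS * ((a + a ^ 2) * err P f + a * e) = nS * a * ((1 + a) * err P f + e) := by ring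
    _ ≤ nS * a * empErr S f := by gcongr
    _ = a * ∑ j, mislabel f (S j) := by rw [← natCast_mul_empErr]; ring

theorem err_mixture_le (hw : ∀ i, 0 ≤ w i) (hW : 0 < ∑ i, w i) (hq : ∀ i, err (D i) f ≤ q) :
    err (mixture D w) f ≤ q := by
  rw [err_mixture D hw, div_le_iff₀ hW, Finset.mul_sum]
  exact Finset.sum_le_sum fun i _ => by
    rw [mul_comm q]
    exact mul_le_mul_of_nonneg_left (hq i) (hw i)

theorem measureReal_compl_accurateSamples_le (hd : vcDim F ≤ d) (hERM : IsERM F O)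
    (hO : Measurable fun p : Sample X nS × X => O nS p.1 p.2) (ha : 0 < a) (ha1 : a ≤ 1 / 3)
    (he : 0 < e) (he1 : e ≤ 1) (hne : 1 ≤ a * e * nS) (hf : f ∈ F) (hfm : Measurable f)
    (hq : ∀ i, err (D i) f ≤ q) (hw : ∀ i, 0 ≤ w i) (hW : 0 < ∑ i, w i) :
    (Measure.pi fun _ : Fin nS => mixture D w).real
        (accurateSamples D O a e ((1 + a) * q + e) w)ᶜ ≤
      2 * (16 / (a * e)) ^ d * Real.exp (-(a * e * nS / 8)) + Real.exp (-(a * e * nS)) := by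
  have := isProbabilityMeasure_mixture D hw hW
  refine (measureReal_mono ?_).trans ((measureReal_union_le _ _).trans (add_le_add
    (measureReal_err_gt_le hd (fun S => (hERM nS S).1) hO ha ha1 he he1 hne (mixture D w))
    (measureReal_empErr_gt_le (e := e) (mixture D w) hfm ha (by linarith))))
  intro S hS
  by_contra hgood
  simp only [Set.mem_union, Set.mem_ofPred_eq, not_or, not_lt] at hgood
  refine hS ⟨hgood.1, ?_⟩
  calc empErr S (O nS S) ≤ empErr S f := (hERM nS S).2 f hf
    _ ≤ (1 + a) * err (mixture D w) f + e := hgood.2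
    _ ≤ (1 + a) * q + e := by
        gcongr
        exact err_mixture_le hw hW hq

end AccurateRound

section Guarantee

variable {α ε δ : ℝ} {k : ℕ}

theorem innerAlpha_pos (hα : 0 < α) : 0 < innerAlpha α :=
  div_pos hα (by norm_num)

theorem innerEps_pos (hε : 0 < ε) : 0 < innerEps ε :=
  div_pos hε (by norm_num)

theorem innerEps_lt (hε1 : ε < 1) : innerEps ε < 1 / 29 := by
  unfold innerEps
  linarith

theorem innerAlpha_le (hα1 : α ≤ 1) : innerAlpha α ≤ 1 / 15 := by
  unfold innerAlpha
  linarith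

theorem pos_of_innerEps_le_innerAlpha (hε : 0 < ε) (hεα : innerEps ε ≤ innerAlpha α) : 0 < α := by
  unfold innerEps innerAlpha at hεα
  linarith

theorem two_le_log_inv_innerEps (hε : 0 < ε) (hε1 : ε < 1) : 2 ≤ Real.log (1 / innerEps ε) := by
  rw [Real.le_log_iff_exp_le (one_div_pos.2 (innerEps_pos hε)), innerEps, one_div_div,
    le_div_iff₀ hε, ← one_add_one_eq_two, Real.exp_add]
  nlinarith [Real.exp_one_lt_d9, Real.exp_pos 1]

theorem rounds_pos (hk : 0 < k) (hδ : 0 < δ) (hδ1 : δ < 1) (hε : 0 < ε) (hα : 0 < α) :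
    0 < rounds k α ε δ := by
  have hk1 : (1 : ℝ) ≤ k := Nat.one_le_cast.2 hk
  have hlog : 0 < Real.log (4 * k / δ) := Real.log_pos (by rw [one_lt_div hδ]; linarith)
  exact Nat.mul_pos two_pos (Nat.ceil_pos.2
    (div_pos hlog (mul_pos (innerEps_pos hε) (pow_pos (innerAlpha_pos hα) 2))))

theorem log_le_rounds (hε : 0 < ε) (hα : 0 < α) :
    Real.log (4 * k / δ) ≤ innerEps ε * innerAlpha α ^ 2 * rounds k α ε δ / 2 := by
  have hceil := Nat.le_ceil (Real.log (4 * k / δ) / (innerEps ε * innerAlpha α ^ 2))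
  rw [div_le_iff₀ (mul_pos (innerEps_pos hε) (pow_pos (innerAlpha_pos hα) 2))] at hceil
  unfold rounds
  push_cast
  linarith

theorem innerDelta_pos (hδ : 0 < δ) (ht : 0 < rounds k α ε δ) : 0 < innerDelta k α ε δ :=
  div_pos hδ (by positivity)

theorem innerDelta_le (hδ1 : δ < 1) (ht : 0 < rounds k α ε δ) : innerDelta k α ε δ ≤ 1 / 3 := by
  have ht1 : (1 : ℝ) ≤ rounds k α ε δ := Nat.one_le_cast.2 ht
  rw [innerDelta, div_le_iff₀ (by positivity)]
  linarith

theorem sizeT_pos {cT : ℝ} (hcT : 0 < cT) (hε : 0 < ε) (hε1 : ε < 1) (hα : 0 < α) :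
    0 < sizeT cT α ε :=
  Nat.ceil_pos.2 (mul_pos (div_pos hcT (mul_pos (innerAlpha_pos hα) (innerEps_pos hε)))
    (by linarith [two_le_log_inv_innerEps hε hε1]))

theorem le_mul_natCast_of_div_mul_le {a e c B : ℝ} {n : ℕ} (hae : 0 < a * e) (hB : 0 ≤ B)
    (hc : 24 ≤ c) (hn : c / (a * e) * B ≤ n) : 24 * B ≤ a * e * n := by
  rw [div_mul_eq_mul_div, div_le_iff₀' hae] at hn
  exact (mul_le_mul_of_nonneg_right hc hB).trans hn

theorem sixteen_div_le_exp {a e : ℝ} (hea : e ≤ a) (he : 0 < e) (he1 : e ≤ 1 / 16) :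
    16 / (a * e) ≤ Real.exp (3 * Real.log (1 / e)) := by
  rw [← Nat.cast_ofNat (n := 3), Real.exp_nat_mul, Real.exp_log (one_div_pos.2 he), div_pow,
    one_pow, div_le_div_iff₀ (mul_pos (he.trans_le hea) he) (pow_pos he 3)]
  calc 16 * e ^ 3 = 16 * e * (e * e) := by ring
    _ ≤ 1 * (a * e) := by
        gcongr
        linarith

theorem round_failure_le {a e δ' : ℝ} {d n : ℕ} (hea : e ≤ a) (he : 0 < e) (he1 : e ≤ 1 / 16)
    (hδ : 0 < δ') (hδ1 : δ' ≤ 1 / 3)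
    (hn : 24 * (d * Real.log (1 / e) + Real.log (1 / δ')) ≤ a * e * n) :
    2 * (16 / (a * e)) ^ d * Real.exp (-(a * e * n / 8)) + Real.exp (-(a * e * n)) ≤ 2 * δ' := by
  have ha : 0 < a := he.trans_le hea
  have hL : 0 ≤ d * Real.log (1 / e) :=
    mul_nonneg d.cast_nonneg (Real.log_nonneg (by rw [le_div_iff₀ he]; linarith))
  have hΔ : 1 ≤ Real.log (1 / δ') := by
    rw [Real.le_log_iff_exp_le (one_div_pos.2 hδ), le_div_iff₀ hδ]
    nlinarith [Real.exp_one_lt_d9, Real.exp_pos 1]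
  have hexp : Real.exp (-Real.log (1 / δ')) = δ' := by
    rw [one_div, Real.log_inv, neg_neg, Real.exp_log hδ]
  have htwo : 2 ≤ Real.exp (2 * Real.log (1 / δ')) := by
    linarith [Real.add_one_le_exp (2 * Real.log (1 / δ'))]
  have hgrowth : (16 / (a * e)) ^ d ≤ Real.exp (d * (3 * Real.log (1 / e))) := by
    rw [Real.exp_nat_mul]
    gcongr
    exact sixteen_div_le_exp hea he he1
  have huniform : 2 * (16 / (a * e)) ^ d * Real.exp (-(a * e * n / 8)) ≤ δ' :=
    calc 2 * (16 / (a * e)) ^ d * Real.exp (-(a * e * n / 8))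
        ≤ Real.exp (2 * Real.log (1 / δ')) * Real.exp (d * (3 * Real.log (1 / e))) *
          Real.exp (-(a * e * n / 8)) := by gcongr
      _ = Real.exp (2 * Real.log (1 / δ') + d * (3 * Real.log (1 / e)) + -(a * e * n / 8)) := by
          rw [Real.exp_add, Real.exp_add]
      _ ≤ Real.exp (-Real.log (1 / δ')) := Real.exp_le_exp.2 (by linarith)
      _ = δ' := hexp
  have hchernoff : Real.exp (-(a * e * n)) ≤ δ' :=
    (Real.exp_le_exp.2 (by linarith)).trans_eq hexp
  linarith

theorem error_bound_le {a e x : ℝ} (ha : 0 ≤ a) (ha1 : a ≤ 1 / 15) (he : 0 ≤ e) (hx : 0 ≤ x) :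
    (1 + a) / (1 - a / 3) * ((1 + 3 * a) * ((1 + a) * (x + e) + e) + 3 * e) ≤
      (1 + 15 * a) * x + 29 * e := by
  have ha2 : 0 ≤ a * (1 / 15 - a) := mul_nonneg ha (sub_nonneg.2 ha1)
  have ha3 : 0 ≤ a * (a * (1 / 15 - a)) := mul_nonneg ha ha2
  have hcoeff_x : (1 + a) * (1 + 3 * a) * (1 + a) ≤ (1 + 15 * a) * (1 - a / 3) := by nlinarith
  have hcoeff_e : (1 + a) * ((1 + 3 * a) * (2 + a) + 3) ≤ 29 * (1 - a / 3) := by nlinarith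
  rw [div_mul_eq_mul_div, div_le_iff₀ (by linarith)]
  linarith [mul_le_mul_of_nonneg_right hcoeff_x hx, mul_le_mul_of_nonneg_right hcoeff_e he]

theorem opt_nonneg {X : Type*} [MeasurableSpace X] (D : Fin k → Measure (X × Bool))
    (F : Set (X → Bool)) : 0 ≤ opt D F :=
  Real.iInf_nonneg fun f => Real.iSup_nonneg fun i => err_nonneg (D i) f

theorem exists_err_le_opt_add {X : Type*} [MeasurableSpace X] (D : Fin k → Measure (X × Bool))
    {F : Set (X → Bool)} (hF : F.Nonempty) {η : ℝ} (hη : 0 < η) :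
    ∃ f ∈ F, ∀ i, err (D i) f ≤ opt D F + η := by
  have := hF.to_subtype
  obtain ⟨f, hf⟩ := exists_lt_of_ciInf_lt
    (f := fun f : F => ⨆ i, err (D i) f) (lt_add_of_pos_right (opt D F) hη)
  exact ⟨f, f.2, fun i => (le_ciSup (f := fun i => err (D i) f)
    (Set.finite_range _).bddAbove i).trans hf.le⟩

theorem measureReal_compl_accurateSamples_le_innerDelta {X : Type*} [MeasurableSpace X]
    {F : Set (X → Bool)} {d : ℕ} {O : ∀ n : ℕ, Sample X n → X → Bool}
    {D : Fin k → Measure (X × Bool)} [∀ i, IsProbabilityMeasure (D i)] {cS : ℝ} (hcS : 24 ≤ cS)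
    (hne : F.Nonempty) (hF : ∀ f ∈ F, Measurable f) (hd : vcDim F ≤ d) (hERM : IsERM F O)
    (hO : Measurable fun p : Sample X (sizeS cS d k α ε δ) × X => O _ p.1 p.2) (hk : 0 < k)
    (hε : 0 < ε) (hε1 : ε < 1) (hδ : 0 < δ) (hδ1 : δ < 1) (hεα : innerEps ε ≤ innerAlpha α)
    (hα1 : α ≤ 1) {w : Fin k → ℝ} (hw : ∀ i, 0 ≤ w i) (hW : 0 < ∑ i, w i) :
    (Measure.pi fun _ : Fin (sizeS cS d k α ε δ) => mixture D w).real
        (accurateSamples D O (innerAlpha α) (innerEps ε)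
          ((1 + innerAlpha α) * (opt D F + innerEps ε) + innerEps ε) w)ᶜ ≤
      2 * innerDelta k α ε δ := by
  have hα := pos_of_innerEps_le_innerAlpha hε hεα
  have ht : 0 < rounds k α ε δ := rounds_pos hk hδ hδ1 hε hα
  have ha := innerAlpha_pos hα
  have ha1 := innerAlpha_le hα1
  have he := innerEps_pos hε
  have he1 := innerEps_lt hε1
  have hδ' := innerDelta_pos hδ ht
  have hδ'1 := innerDelta_le hδ1 ht
  have hL : 0 ≤ d * Real.log (1 / innerEps ε) :=
    mul_nonneg d.cast_nonneg (by linarith [two_le_log_inv_innerEps hε hε1])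
  have hΔ : 0 ≤ Real.log (1 / innerDelta k α ε δ) :=
    Real.log_nonneg (by rw [one_le_div hδ']; linarith)
  have hsize : 24 * (d * Real.log (1 / innerEps ε) + Real.log (1 / innerDelta k α ε δ)) ≤
      innerAlpha α * innerEps ε * sizeS cS d k α ε δ :=
    le_mul_natCast_of_div_mul_le (mul_pos ha he) (add_nonneg hL hΔ) hcS (Nat.le_ceil _)
  have hsize1 : 1 ≤ innerAlpha α * innerEps ε * sizeS cS d k α ε δ := by
    have := Real.one_sub_inv_le_log_of_pos (one_div_pos.2 hδ')
    rw [one_div, inv_inv, ← one_div] at this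
    linarith
  obtain ⟨f, hf, hfopt⟩ := exists_err_le_opt_add D hne he
  exact (measureReal_compl_accurateSamples_le hd hERM hO ha (by linarith) he (by linarith)
    hsize1 hf (hF f hf) hfopt hw hW).trans
      (round_failure_le hεα he (by linarith) hδ' hδ'1 hsize)

theorem nr2avgLaw_expectedErr_le {X : Type*} [MeasurableSpace X] {F : Set (X → Bool)} {d : ℕ}
    {O : ∀ n : ℕ, Sample X n → X → Bool} {D : Fin k → Measure (X × Bool)}
    [∀ i, IsProbabilityMeasure (D i)] {cS cT : ℝ} (hcS : 24 ≤ cS) (hcT : 0 < cT)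
    (hne : F.Nonempty) (hF : ∀ f ∈ F, Measurable f) (hd : vcDim F ≤ d) (hERM : IsERM F O)
    (hO : Measurable fun p : Sample X (sizeS cS d k α ε δ) × X => O _ p.1 p.2) (hk : 0 < k)
    (hε : 0 < ε) (hε1 : ε < 1) (hδ : 0 < δ) (hδ1 : δ < 1) (hεα : innerEps ε ≤ innerAlpha α)
    (hα1 : α ≤ 1) :
    ENNReal.ofReal (1 - δ) ≤ nr2avgLaw D O cS cT d α ε δ
      {h | ∀ i : Fin k, expectedErr (D i) (nr2avgOutput O h) ≤ (1 + α) * opt D F + ε} := by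
  have hα := pos_of_innerEps_le_innerAlpha hε hεα
  have ht : 0 < rounds k α ε δ := rounds_pos hk hδ hδ1 hε hα
  have ha := innerAlpha_pos hα
  have ha1 := innerAlpha_le hα1
  have he := innerEps_pos hε
  have hopt := opt_nonneg D F
  have hrun := runLaw_average_err_le (D := D) hO ha (by linarith) he hk (sizeT_pos hcT hε hε1 hα)
    (mul_pos two_pos (innerDelta_pos hδ ht)).le
    (fun r h => measureReal_compl_accurateSamples_le_innerDelta hcS hne hF hd hERM hO hk hε hε1
      hδ hδ1 hεα hα1 (fun i => (weight_pos ha.le he r h i).le) (sum_weight_pos ha.le he hk r h))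
    ht (M := 4 * k / δ) (by positivity) (log_le_rounds hε hα)
  have hδ_eq : rounds k α ε δ * (2 * innerDelta k α ε δ) + 2 * (k / (4 * k / δ)) = δ := by
    rw [innerDelta]
    field_simp
    norm_num
  rw [hδ_eq] at hrun
  refine hrun.trans (measure_mono fun h hh i => ?_)
  have hmeas : ∀ r, Measurable (roundClassifier O (h r)) := fun r => hF _ (hERM _ _).1
  rw [nr2avgOutput, expectedErr_mixClassifier (D i) hmeas]
  refine (hh i).trans ((error_bound_le ha.le ha1 he.le hopt).trans_eq ?_)
  rw [innerAlpha, innerEps, mul_div_cancel₀ α (by norm_num), mul_div_cancel₀ ε (by norm_num)]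

end Guarantee

section SampleComplexity

variable {α ε δ cS cT : ℝ} {d k : ℕ}

theorem rounds_le (hkδ : 2 * δ ≤ k) (hδ : 0 < δ) (hε : 0 < ε) (hε1 : ε < 1) (hα : 0 < α)
    (hα1 : α ≤ 1) :
    (rounds k α ε δ : ℝ) ≤ 10 * Real.log (k / δ) / (innerEps ε * innerAlpha α ^ 2) := by
  have hA : 0 < innerEps ε * innerAlpha α ^ 2 :=
    mul_pos (innerEps_pos hε) (pow_pos (innerAlpha_pos hα) 2)
  have hA1 : innerEps ε * innerAlpha α ^ 2 ≤ 1 :=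
    mul_le_one₀ (by linarith [innerEps_lt hε1]) (sq_nonneg _)
      (pow_le_one₀ (innerAlpha_pos hα).le (by linarith [innerAlpha_le hα1]))
  have hkδ2 : 2 ≤ k / δ := by rwa [le_div_iff₀ hδ]
  have hQ : Real.log 2 ≤ Real.log (k / δ) := Real.log_le_log two_pos hkδ2
  have hlog2 : 1 / 2 < Real.log 2 := by linarith [Real.log_two_gt_d9]
  have hlog4 : Real.log (4 * k / δ) ≤ 3 * Real.log (k / δ) := by
    rw [mul_div_assoc, Real.log_mul (by norm_num) (by linarith),
      show (4 : ℝ) = 2 ^ 2 by norm_num, Real.log_pow]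
    push_cast
    linarith
  set A := innerEps ε * innerAlpha α ^ 2
  have hceil : (⌈Real.log (4 * k / δ) / A⌉₊ : ℝ) ≤ 3 * Real.log (k / δ) / A + 1 :=
    calc (⌈Real.log (4 * k / δ) / A⌉₊ : ℝ) ≤ ⌈3 * Real.log (k / δ) / A⌉₊ := by gcongr
      _ ≤ 3 * Real.log (k / δ) / A + 1 :=
          (Nat.ceil_lt_add_one (div_nonneg (by linarith) hA.le)).le
  have hone : 1 ≤ 2 * Real.log (k / δ) / A := by
    rw [le_div_iff₀ hA]
    linarith
  rw [rounds, Nat.cast_mul, Nat.cast_two]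
  calc 2 * (⌈Real.log (4 * k / δ) / A⌉₊ : ℝ)
      ≤ 2 * (3 * Real.log (k / δ) / A + 2 * Real.log (k / δ) / A) := by linarith
    _ = 10 * Real.log (k / δ) / A := by ring

theorem log_forty_le_four : Real.log 40 ≤ 4 := by
  rw [Real.log_le_iff_le_exp (by norm_num)]
  calc (40 : ℝ) ≤ 2.7 ^ 4 := by norm_num
    _ ≤ Real.exp 1 ^ 4 := by
        gcongr
        linarith [Real.exp_one_gt_d9]
    _ = Real.exp 4 := by rw [← Real.exp_nat_mul, mul_one, Nat.cast_ofNat]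

theorem inv_innerDelta_le (hkδ : 2 * δ ≤ k) (hδ : 0 < δ) (hε : 0 < ε) (hε1 : ε < 1)
    (hεα : innerEps ε ≤ innerAlpha α) (hα1 : α ≤ 1) :
    1 / innerDelta k α ε δ ≤
      40 * (Real.log (k / δ) * ((1 / innerEps ε) ^ 3 * (1 / δ))) := by
  have he := innerEps_pos hε
  have hQ : 0 < Real.log (k / δ) := Real.log_pos (by rw [lt_div_iff₀ hδ]; linarith)
  have hrounds : (rounds k α ε δ : ℝ) ≤ 10 * Real.log (k / δ) / innerEps ε ^ 3 :=
    calc (rounds k α ε δ : ℝ) ≤ 10 * Real.log (k / δ) / (innerEps ε * innerAlpha α ^ 2) :=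
          rounds_le hkδ hδ hε hε1 (pos_of_innerEps_le_innerAlpha hε hεα) hα1
      _ ≤ 10 * Real.log (k / δ) / (innerEps ε * innerEps ε ^ 2) := by gcongr
      _ = 10 * Real.log (k / δ) / innerEps ε ^ 3 := by rw [← pow_succ']
  calc 1 / innerDelta k α ε δ = 4 * rounds k α ε δ / δ := by rw [innerDelta, one_div_div]
    _ ≤ 4 * (10 * Real.log (k / δ) / innerEps ε ^ 3) / δ := by gcongr
    _ = 40 * (Real.log (k / δ) * ((1 / innerEps ε) ^ 3 * (1 / δ))) := by ring

theorem log_log_div_le (hk : 0 < k) (hkδ : 2 * δ ≤ k) (hδ : 0 < δ) :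
    Real.log (Real.log (k / δ)) ≤ k + Real.log (1 / δ) := by
  have hk0 : (0 : ℝ) < k := Nat.cast_pos.2 hk
  have hQ : 0 < Real.log (k / δ) := Real.log_pos (by rw [lt_div_iff₀ hδ]; linarith)
  calc Real.log (Real.log (k / δ)) ≤ Real.log (k / δ) := Real.log_le_self hQ.le
    _ = Real.log k + Real.log (1 / δ) := by
        rw [div_eq_mul_one_div, Real.log_mul hk0.ne' (by positivity)]
    _ ≤ k + Real.log (1 / δ) := by
        gcongr
        exact Real.log_le_self hk0.le

theorem log_inv_innerDelta_le (hk : 0 < k) (hkδ : 2 * δ ≤ k) (hδ : 0 < δ) (hδ1 : δ < 1)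
    (hε : 0 < ε) (hε1 : ε < 1) (hεα : innerEps ε ≤ innerAlpha α) (hα1 : α ≤ 1) :
    Real.log (1 / innerDelta k α ε δ) ≤
      6 * k * Real.log (1 / innerEps ε) + 2 * Real.log (1 / δ) := by
  have he := innerEps_pos hε
  have hk1 : (1 : ℝ) ≤ k := Nat.one_le_cast.2 hk
  have hL := two_le_log_inv_innerEps hε hε1
  have hQ : 0 < Real.log (k / δ) := Real.log_pos (by rw [lt_div_iff₀ hδ]; linarith)
  have hδ' : 0 < innerDelta k α ε δ := innerDelta_pos hδ
    (rounds_pos hk hδ hδ1 hε (pos_of_innerEps_le_innerAlpha hε hεα))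
  have hloglog := log_log_div_le hk hkδ hδ
  have hkL : 1 * (Real.log (1 / innerEps ε) - 1) ≤ k * (Real.log (1 / innerEps ε) - 1) :=
    mul_le_mul_of_nonneg_right hk1 (by linarith)
  calc Real.log (1 / innerDelta k α ε δ)
      ≤ Real.log (40 * (Real.log (k / δ) * ((1 / innerEps ε) ^ 3 * (1 / δ)))) :=
        Real.log_le_log (one_div_pos.2 hδ') (inv_innerDelta_le hkδ hδ hε hε1 hεα hα1)
    _ = Real.log 40 + (Real.log (Real.log (k / δ)) +
          (3 * Real.log (1 / innerEps ε) + Real.log (1 / δ))) := by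
        rw [Real.log_mul (by norm_num) (by positivity), Real.log_mul hQ.ne' (by positivity),
          Real.log_mul (by positivity) (by positivity), Real.log_pow, Nat.cast_ofNat]
    _ ≤ 6 * k * Real.log (1 / innerEps ε) + 2 * Real.log (1 / δ) := by
        nlinarith [log_forty_le_four]

theorem log_inv_innerEps_le (hε : 0 < ε) (hε1 : ε ≤ 29 / 30) :
    Real.log (1 / innerEps ε) ≤ 106 * Real.log (1 / ε) := by
  have hlog29 : Real.log 29 ≤ 7 / 2 :=
    calc Real.log 29 ≤ Real.log (2 ^ 5) := Real.log_le_log (by norm_num) (by norm_num)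
      _ = 5 * Real.log 2 := by rw [Real.log_pow, Nat.cast_ofNat]
      _ ≤ 7 / 2 := by linarith [Real.log_two_lt_d9]
  have hlogε : 1 / 30 ≤ Real.log (1 / ε) := by
    have := Real.one_sub_inv_le_log_of_pos (one_div_pos.2 hε)
    rw [one_div, inv_inv] at this
    rw [one_div ε]
    linarith
  calc Real.log (1 / innerEps ε) = Real.log 29 + Real.log (1 / ε) := by
        rw [innerEps, one_div_div, div_eq_mul_one_div, Real.log_mul (by norm_num) (by positivity)]
    _ ≤ 106 * Real.log (1 / ε) := by linarith

theorem one_le_one_div_innerAlpha_mul_innerEps (hε : 0 < ε) (hε1 : ε < 1) (hα : 0 < α)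
    (hα1 : α ≤ 1) : 1 ≤ 1 / (innerAlpha α * innerEps ε) := by
  have hae := mul_pos (innerAlpha_pos hα) (innerEps_pos hε)
  rw [one_le_div hae]
  exact mul_le_one₀ (by linarith [innerAlpha_le hα1]) (innerEps_pos hε).le
    (by linarith [innerEps_lt hε1])

theorem sizeS_le (hcS : 0 < cS) (hk : 0 < k) (hkδ : 2 * δ ≤ k) (hδ : 0 < δ) (hδ1 : δ < 1)
    (hε : 0 < ε) (hε1 : ε < 1) (hεα : innerEps ε ≤ innerAlpha α) (hα1 : α ≤ 1) :
    (sizeS cS d k α ε δ : ℝ) ≤ (6 * cS + 1) * (1 / (innerAlpha α * innerEps ε) *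
      ((d + k) * Real.log (1 / innerEps ε) + Real.log (1 / δ))) := by
  have hα := pos_of_innerEps_le_innerAlpha hε hεα
  have hae := mul_pos (innerAlpha_pos hα) (innerEps_pos hε)
  have hae1 := one_le_one_div_innerAlpha_mul_innerEps hε hε1 hα hα1
  have hk1 : (1 : ℝ) ≤ k := Nat.one_le_cast.2 hk
  have hL := two_le_log_inv_innerEps hε hε1
  have hdL : 0 ≤ d * Real.log (1 / innerEps ε) := mul_nonneg d.cast_nonneg (by linarith)
  have hkL : 1 * 2 ≤ k * Real.log (1 / innerEps ε) := by gcongr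
  have hδL : 0 ≤ Real.log (1 / δ) := Real.log_nonneg (by rw [one_le_div hδ]; exact hδ1.le)
  have ht := rounds_pos hk hδ hδ1 hε hα
  have hδ' := innerDelta_pos hδ ht
  have hΔ0 : 0 ≤ Real.log (1 / innerDelta k α ε δ) :=
    Real.log_nonneg (by rw [one_le_div hδ']; linarith [innerDelta_le hδ1 ht])
  have hΔ := log_inv_innerDelta_le hk hkδ hδ hδ1 hε hε1 hεα hα1
  have hlogs : d * Real.log (1 / innerEps ε) + Real.log (1 / innerDelta k α ε δ) ≤
      6 * ((d + k) * Real.log (1 / innerEps ε) + Real.log (1 / δ)) := by linarith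
  have hY1 : 1 ≤ (d + k) * Real.log (1 / innerEps ε) + Real.log (1 / δ) := by linarith
  set Y := (d + k) * Real.log (1 / innerEps ε) + Real.log (1 / δ)
  calc (sizeS cS d k α ε δ : ℝ)
      ≤ cS / (innerAlpha α * innerEps ε) *
          (d * Real.log (1 / innerEps ε) + Real.log (1 / innerDelta k α ε δ)) + 1 :=
        (Nat.ceil_lt_add_one
          (mul_nonneg (div_nonneg hcS.le hae.le) (add_nonneg hdL hΔ0))).le
    _ ≤ cS / (innerAlpha α * innerEps ε) * (6 * Y) + 1 / (innerAlpha α * innerEps ε) * Y := by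
        gcongr
        exact one_le_mul_of_one_le_of_one_le hae1 hY1
    _ = (6 * cS + 1) * (1 / (innerAlpha α * innerEps ε) * Y) := by ring

theorem mul_sizeT_le (hcT : 0 < cT) (hδ : 0 < δ) (hδ1 : δ < 1) (hε : 0 < ε) (hε1 : ε < 1)
    (hα : 0 < α) (hα1 : α ≤ 1) :
    k * (sizeT cT α ε : ℝ) ≤ (cT + 1) * (1 / (innerAlpha α * innerEps ε) *
      ((d + k) * Real.log (1 / innerEps ε) + Real.log (1 / δ))) := by
  have hae := mul_pos (innerAlpha_pos hα) (innerEps_pos hε)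
  have hae1 := one_le_one_div_innerAlpha_mul_innerEps hε hε1 hα hα1
  have hL := two_le_log_inv_innerEps hε hε1
  have hdL : 0 ≤ d * Real.log (1 / innerEps ε) := mul_nonneg d.cast_nonneg (by linarith)
  have hkL : k ≤ k * Real.log (1 / innerEps ε) :=
    le_mul_of_one_le_right k.cast_nonneg (by linarith)
  have hδL : 0 ≤ Real.log (1 / δ) := Real.log_nonneg (by rw [one_le_div hδ]; exact hδ1.le)
  have hkLY : k * Real.log (1 / innerEps ε) ≤
      (d + k) * Real.log (1 / innerEps ε) + Real.log (1 / δ) := by linarith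
  set Y := (d + k) * Real.log (1 / innerEps ε) + Real.log (1 / δ)
  have hkY : 1 * (k : ℝ) ≤ 1 / (innerAlpha α * innerEps ε) * Y := by
    gcongr
    exact hkL.trans hkLY
  calc k * (sizeT cT α ε : ℝ)
      ≤ k * (cT / (innerAlpha α * innerEps ε) * Real.log (1 / innerEps ε) + 1) := by
        gcongr
        exact (Nat.ceil_lt_add_one
          (mul_nonneg (div_nonneg hcT.le hae.le) (by linarith))).le
    _ = cT / (innerAlpha α * innerEps ε) * (k * Real.log (1 / innerEps ε)) + 1 * k := by ring
    _ ≤ cT / (innerAlpha α * innerEps ε) * Y + 1 / (innerAlpha α * innerEps ε) * Y := by gcongr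
    _ = (cT + 1) * (1 / (innerAlpha α * innerEps ε) * Y) := by ring

theorem nr2avgSamples_le (hcS : 0 < cS) (hcT : 0 < cT) (hk : 0 < k) (hkδ : 2 * δ ≤ k)
    (hδ : 0 < δ) (hδ1 : δ < 1) (hε : 0 < ε) (hε1 : ε ≤ 29 / 30)
    (hεα : innerEps ε ≤ innerAlpha α) (hα1 : α ≤ 1) :
    (nr2avgSamples cS cT d k α ε δ : ℝ) ≤
      10 * (6 * cS + cT + 2) * 106 * (15 ^ 3 * 29 ^ 2) *
        (1 / (α ^ 3 * ε ^ 2) * Real.log (k / δ) *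
          ((d + k) * Real.log (1 / ε) + Real.log (1 / δ))) := by
  have hε_one : ε < 1 := by linarith
  have hα := pos_of_innerEps_le_innerAlpha hε hεα
  have ha := innerAlpha_pos hα
  have he := innerEps_pos hε
  have hQ : 0 ≤ Real.log (k / δ) := Real.log_nonneg (by rw [one_le_div hδ]; linarith)
  have hδL : 0 ≤ Real.log (1 / δ) := Real.log_nonneg (by rw [one_le_div hδ]; exact hδ1.le)
  have hlogs : (d + k) * Real.log (1 / innerEps ε) + Real.log (1 / δ) ≤
      106 * ((d + k) * Real.log (1 / ε) + Real.log (1 / δ)) :=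
    calc (d + k) * Real.log (1 / innerEps ε) + Real.log (1 / δ)
        ≤ (d + k) * (106 * Real.log (1 / ε)) + 106 * Real.log (1 / δ) := by
          gcongr
          · exact log_inv_innerEps_le hε hε1
          · linarith
      _ = 106 * ((d + k) * Real.log (1 / ε) + Real.log (1 / δ)) := by ring
  have hsizes : sizeS cS d k α ε δ + k * (sizeT cT α ε : ℝ) ≤
      (6 * cS + cT + 2) * (1 / (innerAlpha α * innerEps ε) *
        (106 * ((d + k) * Real.log (1 / ε) + Real.log (1 / δ)))) :=
    calc sizeS cS d k α ε δ + k * (sizeT cT α ε : ℝ)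
        ≤ (6 * cS + cT + 2) * (1 / (innerAlpha α * innerEps ε) *
            ((d + k) * Real.log (1 / innerEps ε) + Real.log (1 / δ))) := by
          linarith [sizeS_le (d := d) hcS hk hkδ hδ hδ1 hε hε_one hεα hα1,
            mul_sizeT_le (k := k) (d := d) hcT hδ hδ1 hε hε_one hα hα1]
      _ ≤ _ := by gcongr
  rw [nr2avgSamples, Nat.cast_mul, Nat.cast_add, Nat.cast_mul]
  calc (rounds k α ε δ : ℝ) * (sizeS cS d k α ε δ + k * sizeT cT α ε)
      ≤ 10 * Real.log (k / δ) / (innerEps ε * innerAlpha α ^ 2) * ((6 * cS + cT + 2) *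
          (1 / (innerAlpha α * innerEps ε) *
            (106 * ((d + k) * Real.log (1 / ε) + Real.log (1 / δ))))) :=
        mul_le_mul (rounds_le hkδ hδ hε hε_one hα hα1) hsizes (by positivity) (by positivity)
    _ = _ := by
        rw [innerAlpha, innerEps]
        field_simp

end SampleComplexity

end CollabPAC

theorem theorem6_general {cS cT : ℝ} (hcS : 24 ≤ cS) (hcT : 0 < cT) :
    ∃ K : ℝ, 0 < K ∧
      ∀ (X : Type*) [MeasurableSpace X] (F : Set (X → Bool)) (d : ℕ)
        (O : ∀ n : ℕ, Sample X n → X → Bool) (k : ℕ) (D : Fin k → Measure (X × Bool))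
        [∀ i, IsProbabilityMeasure (D i)] (α ε δ : ℝ),
        F.Nonempty → (∀ f ∈ F, Measurable f) → vcDim F ≤ d → IsERM F O →
        (Measurable fun p : Sample X (sizeS cS d k α ε δ) × X => O _ p.1 p.2) →
        1 ≤ k → 0 < ε → ε < 1 → 0 < δ → δ < 1 → innerEps ε ≤ innerAlpha α → α ≤ 1 →
        ENNReal.ofReal (1 - δ) ≤ nr2avgLaw D O cS cT d α ε δ
            {h | ∀ i : Fin k, expectedErr (D i) (nr2avgOutput O h) ≤ (1 + α) * opt D F + ε} ∧
        (ε ≤ 29 / 30 → 2 * δ ≤ k →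
          (nr2avgSamples cS cT d k α ε δ : ℝ) ≤
            K * (1 / (α ^ 3 * ε ^ 2) * Real.log (k / δ) *
              ((d + k) * Real.log (1 / ε) + Real.log (1 / δ)))) := by
  have hcS_pos : 0 < cS := by linarith
  refine ⟨10 * (6 * cS + cT + 2) * 106 * (15 ^ 3 * 29 ^ 2), by positivity, ?_⟩
  intro X _ F d O k D _ α ε δ hne hF hd hERM hO hk hε hε1 hδ hδ1 hεα hα1
  exact ⟨nr2avgLaw_expectedErr_le hcS hcT hne hF hd hERM hO hk hε hε1 hδ hδ1 hεα hα1,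
    fun hε2 hkδ => nr2avgSamples_le hcS_pos hcT hk hkδ hδ hδ1 hε hε2 hεα hα1⟩

theorem theorem6 :
    ∃ c₀ : ℝ, 0 < c₀ ∧ ∀ cS cT : ℝ, c₀ ≤ cS → c₀ ≤ cT →
      ∃ K : ℝ, 0 < K ∧
        ∀ (X : Type*) [MeasurableSpace X] (F : Set (X → Bool)) (d : ℕ)
          (O : ∀ n : ℕ, Sample X n → X → Bool) (k : ℕ) (D : Fin k → Measure (X × Bool))
          [∀ i, IsProbabilityMeasure (D i)] (α ε δ : ℝ),
          F.Nonempty → (∀ f ∈ F, Measurable f) → vcDim F = d →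
          IsERM F O →
          (∀ n : ℕ, Measurable fun p : Sample X n × X => O n p.1 p.2) →
          1 ≤ k → 0 < ε → ε < 1 → 0 < δ → δ < 1 → 30 * ε / 29 < α → α < 1 →
          ENNReal.ofReal (1 - δ) ≤ nr2avgLaw D O cS cT d α ε δ
              {h | ∀ i : Fin k, expectedErr (D i) (nr2avgOutput O h) ≤ (1 + α) * opt D F + ε} ∧
          (2 * δ ≤ k →
            (nr2avgSamples cS cT d k α ε δ : ℝ) ≤
              K * (1 / (α ^ 3 * ε ^ 2) * Real.log (k / δ) *
                ((d + k) * Real.log (1 / ε) + Real.log (1 / δ)))) := by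
  refine ⟨24, by norm_num, fun cS cT hcS hcT => ?_⟩
  obtain ⟨K, hK, hmain⟩ := theorem6_general hcS (by linarith : 0 < cT)
  refine ⟨K, hK, fun X _ F d O k D _ α ε δ hne hF hd hERM hO hk hε hε1 hδ hδ1 hα hα1 => ?_⟩
  have hεα : innerEps ε ≤ innerAlpha α := by
    rw [innerEps, innerAlpha]
    linarith
  exact (hmain X F d O k D α ε δ hne hF hd.le hERM (hO _) hk hε hε1 hδ hδ1 hεα hα1.le).imp_right
    fun hbound => hbound (by linarith)
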